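/- Let $K$ be a field of characteristic zero with $m$ mutually commuting endomorphisms (translations) $\alpha_1,\dots,\alpha_m$, which are assigned positive integer weights $w_1,\dots,w_m$. Let $T$ be the free commutative semigroup of formal power products $\tau=\alpha_1^{k_1}\cdots\alpha_m^{k_m}$ ($k_i\in\mathbb{N}$), and put $\operatorname{ord}_w\tau=\sum_i w_ik_i$. Let $L$ be a difference field extension of $K$ (a field extension with commuting endomorphisms extending the $\alpha_i$), generated as a difference field by finitely many elements, $L=K\langle\eta_1,\dots,\eta_n\rangle$; that is, $L$ is generated as a field over $K$ by all $\tau\eta_i$ ($\tau\in T$, $1\le i\le n$). For $r\in\mathbb{N}$ let $L_r=K(\{\tau\eta_i : \tau\in T,\ \operatorname{ord}_w\tau\le r,\ 1\le i\le n\})$. A quasi-polynomial is a function $f:\mathbb{Z}\to\mathbb{Q}$ of the form $f(t)=\sum_{i=0}^{d}c_i(t)t^i$, where each coefficient $c_i:\mathbb{Z}\to\mathbb{Q}$ is periodic with some positive integer period; if $c_d\neq 0$ as a function, $d$ is the degree and $c_d$ the leading coefficient (the zero quasi-polynomial has degree $-\infty$ and leading coefficient $0$). Let $\lambda_w$ be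 the Ehrhart quasi-polynomial of the conic polytope $\{x\in\mathbb{R}^m : x_j\ge 0\ (1\le j\le m),\ \sum_i w_ix_i\le 1\}$, i.e. the quasi-polynomial whose value at every integer $r\ge1$ is the number of integer points of its $r$-th dilate $\{x\in\mathbb{R}^m : x_j\ge 0,\ \sum_i w_ix_i\le r\}$. Then there exists a quasi-polynomial $\Phi=\Phi^{(w)}_{\eta|K}$ such that: (i) $\Phi(r)=\operatorname{trdeg}_K L_r$ (in particular this is finite) for all sufficiently large $r\in\mathbb{N}$. (ii) $\deg\Phi\le m$. (iii) $\Phi$ is an alternating sum of Ehrhart quasi-polynomials associated with conic polytopes: there are finitely many signs $\varepsilon_i\in\{1,-1\}$ and shifts $c_i\in\mathbb{N}$ with $\Phi(t)=\sum_i\varepsilon_i\,\lambda_w(t-c_i)$ for all $t\in\mathbb{Z}$. (iv) The leading coefficient of $\Phi$ is constant, and the degree and the leading coefficient do not depend on the choice of generators: if $\zeta_1,\dots,\zeta_k$ is another finite system with $L=K\langle\zeta_1,\dots,\zeta_k\rangle$, then every quasi-polynomial satisfying (i) for $\zeta$ has the same degree and the same leading coefficient as $\Phi$. Furthermore, the coefficient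 of $t^m$ in $\Phi$ is the constant $\dfrac{a}{m!\,w_1\cdots w_m}$, where $a$ is the difference transcendence degree of $L/K$, i.e. the (finite and common) number of elements of the difference transcendence bases of $L$ over $K$. Here $B\subseteq L$ is a difference transcendence basis if the family $(\tau b)_{\tau\in T,\,b\in B}$ is algebraically independent over $K$ and, for every $x\in L$, the family $(\tau x)_{\tau\in T}$ is algebraically dependent over $K\langle B\rangle$. -/

import Mathlib

open scoped Pointwise Nat
open Filter

namespace WeightedDifference

/-! ### Quasi-polynomials -/

/-- Rational periodic numbers: functions `U : ℤ → ℚ` having some period `q ≥ 1`, with pointwise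
operations. The image of `c : ℚ` under `algebraMap` is the constant function `c`. -/
def periodicNumber : Subalgebra ℚ (ℤ → ℚ) where
  carrier := {U | ∃ q : ℕ, 0 < q ∧ Function.Periodic U (q : ℤ)}
  mul_mem' := by
    rintro U V ⟨p, hp, hU⟩ ⟨q, hq, hV⟩
    refine ⟨p * q, Nat.mul_pos hp hq, fun n => ?_⟩
    have h1 : U (n + ((p * q : ℕ) : ℤ)) = U n := by
      have h := hU.nat_mul q n
      push_cast
      rw [mul_comm]
      exact h
    have h2 : V (n + ((p * q : ℕ) : ℤ)) = V n := by
      have h := hV.nat_mul p n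
      push_cast
      exact h
    simp only [Pi.mul_apply, h1, h2]
  add_mem' := by
    rintro U V ⟨p, hp, hU⟩ ⟨q, hq, hV⟩
    refine ⟨p * q, Nat.mul_pos hp hq, fun n => ?_⟩
    have h1 : U (n + ((p * q : ℕ) : ℤ)) = U n := by
      have h := hU.nat_mul q n
      push_cast
      rw [mul_comm]
      exact h
    have h2 : V (n + ((p * q : ℕ) : ℤ)) = V n := by
      have h := hV.nat_mul p n
      push_cast
      exact h
    simp only [Pi.add_apply, h1, h2]
  algebraMap_mem' := fun c => ⟨1, one_pos, fun _ => rfl⟩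

/-- A (univariate) quasi-polynomial `∑ cᵢ(t) tⁱ` whose coefficients `cᵢ` are rational periodic
numbers. Its degree, leading coefficient and the coefficient of `tⁱ` are those of the
polynomial. (The coefficients are determined by the values at all large natural numbers.) -/
abbrev QuasiPolynomial : Type := Polynomial periodicNumber

/-- The value `∑ cᵢ(n) nⁱ` of a quasi-polynomial at an integer `n`. -/
noncomputable def evalAt (f : QuasiPolynomial) (n : ℤ) : ℚ :=
  Polynomial.eval₂ ((Pi.evalRingHom (fun _ : ℤ => ℚ) n).comp
    (periodicNumber.val : periodicNumber →+* (ℤ → ℚ))) (n : ℚ) f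

/-! ### Ehrhart quasi-polynomials of conic polytopes -/

/-- `L(P, r)`: the number of points with integer coordinates in the dilate `r P`. -/
noncomputable def latticeCount {d : ℕ} (P : Set (Fin d → ℝ)) (r : ℕ) : ℕ :=
  Set.ncard {z : Fin d → ℤ | (fun i => (z i : ℝ)) ∈ (r : ℝ) • P}

/-- `f` is the Ehrhart quasi-polynomial of the polytope `P`: `f(r) = L(P, r)` for all `r ≥ 1`. -/
def IsEhrhart {d : ℕ} (P : Set (Fin d → ℝ)) (f : QuasiPolynomial) : Prop :=
  ∀ r : ℕ, 1 ≤ r → evalAt f (r : ℤ) = (latticeCount P r : ℚ)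

/-- The conic polytope of the weights `w`; its `r`-th dilate is `{x ≥ 0 | ∑ wᵢ xᵢ ≤ r}`. -/
def conicPolytope {m : ℕ} (w : Fin m → ℕ) : Set (Fin m → ℝ) :=
  {x | (∀ j, 0 ≤ x j) ∧ ∑ i, (w i : ℝ) * x i ≤ 1}

/-- `Φ(t) = ∑ᵢ ± λ(t - cᵢ)`, a finite sum with signs, where `λ` is the Ehrhart quasi-polynomial
of the conic polytope of the weights `w` and the shifts `cᵢ` are natural numbers. -/
def IsAlternatingEhrhartSum {m : ℕ} (w : Fin m → ℕ) (Φ : QuasiPolynomial) : Prop :=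
  ∃ lam : QuasiPolynomial, IsEhrhart (conicPolytope w) lam ∧
    ∃ (N : ℕ) (ε : Fin N → ℤˣ) (c : Fin N → ℕ),
      ∀ t : ℤ, evalAt Φ t = ∑ i, ((ε i : ℤ) : ℚ) * evalAt lam (t - (c i : ℤ))

/-! ### Difference fields -/

/-- A difference structure on a field: `m` mutually commuting endomorphisms (translations).
They are injective, being ring homomorphisms between fields. -/
structure Translations (m : ℕ) (F : Type*) [Field F] where
  /-- the translations -/
  trans : Fin m → F →+* F
  comm : ∀ i j, (trans i).comp (trans j) = (trans j).comp (trans i)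

/-- The action of the power product `α₁^k₁ ⋯ αₘ^kₘ`. -/
def Translations.transform {m : ℕ} {F : Type*} [Field F] (σ : Translations m F)
    (k : Fin m → ℕ) : F →+* F :=
  (List.ofFn fun i => σ.trans i ^ k i).prod

/-- `L` with the translations `σL` is a difference field extension of `K` with `σK`. -/
def IsDifferenceExtension {m : ℕ} {K L : Type*} [Field K] [Field L] [Algebra K L]
    (σK : Translations m K) (σL : Translations m L) : Prop :=
  ∀ i x, σL.trans i (algebraMap K L x) = algebraMap K L (σK.trans i x)

/-- The weighted order `w₁ k₁ + ⋯ + wₘ kₘ` of the power product with exponents `k`. -/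
def weightedOrder {m : ℕ} (w k : Fin m → ℕ) : ℕ := ∑ i, w i * k i

section

variable (K : Type*) {L : Type*} [Field K] [Field L] [Algebra K L] {m : ℕ} (σ : Translations m L)

/-- The difference field `K⟨S⟩`, generated over `K` by all transforms of elements of `S`. -/
def diffAdjoin (S : Set L) : IntermediateField K L :=
  IntermediateField.adjoin K {x | ∃ k : Fin m → ℕ, ∃ s ∈ S, x = σ.transform k s}

/-- The field `L_r`, generated over `K` by the transforms of the `ηᵢ` of weighted order `≤ r`. -/
def truncation (w : Fin m → ℕ) {n : ℕ} (η : Fin n → L) (r : ℕ) : IntermediateField K L :=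
  IntermediateField.adjoin K
    {x | ∃ k : Fin m → ℕ, weightedOrder w k ≤ r ∧ ∃ i, x = σ.transform k (η i)}

/-- `L = K⟨η₁, …, ηₙ⟩`. -/
def Generates {n : ℕ} (η : Fin n → L) : Prop := diffAdjoin K σ (Set.range η) = ⊤

/-- `Φ(r) = trdeg_K L_r` for all sufficiently large `r` (the transcendence degree, a cardinal,
being a natural number). -/
def IsDimensionQuasiPolynomial (w : Fin m → ℕ) {n : ℕ} (η : Fin n → L)
    (Φ : QuasiPolynomial) : Prop :=
  ∀ᶠ r : ℕ in atTop, ∃ d : ℕ,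
    Algebra.trdeg K (truncation K σ w η r) = (d : Cardinal) ∧ evalAt Φ (r : ℤ) = (d : ℚ)

/-- `B` is a difference transcendence basis of `L` over `K`: the family of all transforms of
elements of `B` is algebraically independent over `K`, and for every `a` in `L` the family of
all transforms of `a` is algebraically dependent over `K⟨B⟩`. -/
structure IsDiffTranscendenceBasis (B : Set L) : Prop where
  indep : AlgebraicIndependent K (fun p : (Fin m → ℕ) × B => σ.transform p.1 (p.2 : L))
  algebraic : ∀ a : L, ¬ AlgebraicIndependent (diffAdjoin K σ B)
    (fun k : Fin m → ℕ => σ.transform k a)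

/-- The difference transcendence degree of `L` over `K` is the natural number `a`: difference
transcendence bases exist, and each of them is finite with exactly `a` elements. -/
def HasDiffTrdeg (a : ℕ) : Prop :=
  (∃ B : Set L, IsDiffTranscendenceBasis K σ B) ∧
    ∀ B : Set L, IsDiffTranscendenceBasis K σ B → B.Finite ∧ B.ncard = a

end

end WeightedDifference

/-! Order the transforms of the generators by a key that refines the weighted order and is
compatible with translation by exponent vectors. Call an exponent `k` of `ηⱼ` leading if that
transform is algebraic over the field generated by the transforms with smaller key. Applying a
translation to an algebraic dependence gives another one, so the leading exponents of each generator
form an upper set `E j` of `ℕ^m`. The transforms that are not leading and have order at most `r`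
form a transcendence basis of `L_r`. Thus `trdeg_K L_r` counts the lattice points of weighted order
at most `r` outside the sets `E j` (`exists_leading_exponents`).

The counting is then combinatorial. Splitting by whether the first exponent is zero gives the
recursion `countCompl_eq_add`. Dickson's lemma turns it into an induction whose base consists of
sets independent of the first coordinate (`IsUpperSet.stepUp_induction`). Discrete summation
(`AgreesWithQuasi.of_sub`) shows that each count is a quasi-polynomial for large `r`. Its
coefficient of order `m` is `1 / (m! ∏ wᵢ)` if `E j` is empty and `0` otherwise. The same induction
expresses the count through signed shifts of the count for `E = ∅`, which is the Ehrhart function of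
the conic polytope. It also shows that the leading coefficient is constant and positive unless the
count vanishes identically. By positivity, sums have no cancellation in the top degree.

Two finite systems of generators have truncations contained in each other up to a shift of `r`, so
the degree and leading coefficient agree. The number of empty `E j` is the difference transcendence
degree. Comparing coefficients of order `m` bounds every independent family by this number
(`card_le_of_algebraicIndependent`), and comparing them for the joint family of a basis and `η`,
with suitable offsets, gives the opposite bound (`IsDiffTranscendenceBasis.le_ncard`). -/

namespace WeightedDifference

/-! ### Functions given by periodic families of polynomials -/

/-- For `t ≥ N`, the value of `f` is `(p t)(t)` for a periodic family `p` of polynomials of degree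
at most `d` all of whose coefficients of order `d` are `e`. -/
def AgreesWithQuasi (d : ℕ) (e : ℚ) (N : ℤ) (f : ℤ → ℚ) : Prop :=
  ∃ q : ℕ, 0 < q ∧ ∃ p : ℤ → Polynomial ℚ, Function.Periodic p (q : ℤ) ∧
    (∀ t, (p t).natDegree ≤ d ∧ (p t).coeff d = e) ∧ ∀ t, N ≤ t → f t = (p t).eval (t : ℚ)

theorem natDegree_comp_X_sub_C_le {p : Polynomial ℚ} {d : ℕ} (hp : p.natDegree ≤ d) (a : ℚ) :
    (p.comp (Polynomial.X - Polynomial.C a)).natDegree ≤ d := by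
  rw [Polynomial.natDegree_comp, Polynomial.natDegree_X_sub_C, mul_one]
  exact hp

theorem coeff_comp_X_sub_C {p : Polynomial ℚ} {d : ℕ} (hp : p.natDegree ≤ d) (a : ℚ) :
    (p.comp (Polynomial.X - Polynomial.C a)).coeff d = p.coeff d := by
  have hX : (Polynomial.X - Polynomial.C a : Polynomial ℚ).natDegree = 1 :=
    Polynomial.natDegree_X_sub_C a
  rcases hp.lt_or_eq with h | rfl
  · rw [Polynomial.coeff_eq_zero_of_natDegree_lt h, Polynomial.coeff_eq_zero_of_natDegree_lt]
    rwa [Polynomial.natDegree_comp, hX, mul_one]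
  · have h := Polynomial.leadingCoeff_comp (p := p) (q := Polynomial.X - Polynomial.C a)
      (by rw [hX]; exact one_ne_zero)
    rw [Polynomial.leadingCoeff, Polynomial.natDegree_comp, hX, mul_one,
      (Polynomial.monic_X_sub_C a).leadingCoeff, one_pow, mul_one] at h
    exact h

namespace AgreesWithQuasi

variable {d : ℕ} {e : ℚ} {N : ℤ} {f : ℤ → ℚ}

theorem mono (h : AgreesWithQuasi d e N f) {M : ℤ} (hM : N ≤ M) : AgreesWithQuasi d e M f := by
  obtain ⟨q, hq, p, hp, hd, hf⟩ := h
  exact ⟨q, hq, p, hp, hd, fun t ht => hf t (hM.trans ht)⟩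

theorem zero (d : ℕ) (N : ℤ) : AgreesWithQuasi d 0 N (fun _ => 0) :=
  ⟨1, one_pos, fun _ => 0, fun _ => rfl, by simp, by simp⟩

theorem add {e' : ℚ} {f' : ℤ → ℚ} (h : AgreesWithQuasi d e N f) (h' : AgreesWithQuasi d e' N f') :
    AgreesWithQuasi d (e + e') N (fun t => f t + f' t) := by
  obtain ⟨q, hq, p, hp, hd, hf⟩ := h
  obtain ⟨q', hq', p', hp', hd', hf'⟩ := h'
  refine ⟨q * q', Nat.mul_pos hq hq', fun t => p t + p' t, fun t => ?_, fun t => ⟨?_, ?_⟩,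
    fun t ht => ?_⟩
  · have h1 := hp.nat_mul q' t
    have h2 := hp'.nat_mul q t
    push_cast
    rw [mul_comm] at h1
    simp only [h1, h2]
  · exact Polynomial.natDegree_add_le_of_degree_le (hd t).1 (hd' t).1
  · rw [Polynomial.coeff_add, (hd t).2, (hd' t).2]
  · simp only [Polynomial.eval_add, hf t ht, hf' t ht]

theorem lift (h : AgreesWithQuasi d e N f) {d' : ℕ} (hd' : d < d') :
    AgreesWithQuasi d' 0 N f := by
  obtain ⟨q, hq, p, hp, hd, hf⟩ := h
  exact ⟨q, hq, p, hp, fun t => ⟨(hd t).1.trans hd'.le,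
    Polynomial.coeff_eq_zero_of_natDegree_lt ((hd t).1.trans_lt hd')⟩, hf⟩

theorem shift (h : AgreesWithQuasi d e N f) (c : ℤ) :
    AgreesWithQuasi d e (N + c) (fun t => f (t - c)) := by
  obtain ⟨q, hq, p, hp, hd, hf⟩ := h
  refine ⟨q, hq, fun t => (p (t - c)).comp (Polynomial.X - Polynomial.C (c : ℚ)), fun t => ?_,
    fun t => ⟨natDegree_comp_X_sub_C_le (hd _).1 _, ?_⟩, fun t ht => ?_⟩
  · simp only
    rw [show t + (q : ℤ) - c = (t - c) + q by ring, hp]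
  · rw [coeff_comp_X_sub_C (hd _).1, (hd _).2]
  · simp [hf (t - c) (by linarith)]

theorem const_mul (h : AgreesWithQuasi d e N f) (a : ℚ) :
    AgreesWithQuasi d (a * e) N (fun t => a * f t) := by
  obtain ⟨q, hq, p, hp, hd, hf⟩ := h
  refine ⟨q, hq, fun t => Polynomial.C a * p t, fun t => ?_,
    fun t => ⟨(Polynomial.natDegree_C_mul_le _ _).trans (hd t).1, ?_⟩, fun t ht => ?_⟩
  · simp only [hp t]
  · rw [Polynomial.coeff_C_mul, (hd t).2]
  · simp [hf t ht]

theorem sum {ι : Type*} (s : Finset ι) {e : ι → ℚ} {f : ι → ℤ → ℚ}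
    (h : ∀ i ∈ s, AgreesWithQuasi d (e i) N (f i)) :
    AgreesWithQuasi d (∑ i ∈ s, e i) N (fun t => ∑ i ∈ s, f i t) := by
  classical
  induction s using Finset.induction_on with
  | empty => simpa using zero d N
  | insert a s ha ih =>
    simp only [Finset.sum_insert ha]
    exact (h a (Finset.mem_insert_self a s)).add
      (ih fun i hi => h i (Finset.mem_insert_of_mem hi))

end AgreesWithQuasi

/-- Polynomials have discrete antiderivatives. -/
theorem exists_eval_sub_eval_sub_eq {Q : ℚ} (hQ : Q ≠ 0) (n : ℕ) (p : Polynomial ℚ)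
    (hp : p.degree < n) :
    ∃ P : Polynomial ℚ, P.degree < (n + 1 : ℕ) ∧
      (∀ j, n = j + 1 → P.coeff n = p.coeff j / (n * Q)) ∧
      ∀ x, P.eval x - P.eval (x - Q) = p.eval x := by
  induction n generalizing p with
  | zero =>
    refine ⟨0, by simp, by simp, fun x => ?_⟩
    have : p = 0 := by
      rw [← Polynomial.degree_eq_bot, ← Nat.WithBot.lt_zero_iff]
      simpa using hp
    simp [this]
  | succ n ih =>
    -- `D` has degree `n` and top coefficient `(n + 1) Q`, so subtracting `a D` removes the top term
    -- of `p`; `a X ^ (n + 1)` is an antiderivative of `a D`.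
    set a : ℚ := p.coeff n / ((n + 1 : ℕ) * Q) with ha
    set D : Polynomial ℚ := Polynomial.X ^ (n + 1) - (Polynomial.X + Polynomial.C (-Q)) ^ (n + 1)
      with hD
    have hDc : ∀ k, n < k → D.coeff k = 0 := by
      intro k hk
      rw [hD, Polynomial.coeff_sub, Polynomial.coeff_X_pow, Polynomial.coeff_X_add_C_pow]
      rcases eq_or_lt_of_le (Nat.succ_le_of_lt hk) with h | h
      · subst h; simp
      · rw [Nat.choose_eq_zero_of_lt h, if_neg (by omega)]; simp
    have hDn : D.coeff n = (n + 1 : ℕ) * Q := by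
      rw [hD, Polynomial.coeff_sub, Polynomial.coeff_X_pow, Polynomial.coeff_X_add_C_pow]
      simp
      ring
    obtain ⟨P, hP, -, hPe⟩ := ih (p - Polynomial.C a * D) (by
      rw [Polynomial.degree_lt_iff_coeff_zero] at hp ⊢
      intro k hk
      rw [Polynomial.coeff_sub, Polynomial.coeff_C_mul]
      rcases eq_or_lt_of_le hk with rfl | h
      · rw [hDn, ha, div_mul_cancel₀, sub_self]
        exact mul_ne_zero (by positivity) hQ
      · rw [hDc k h, hp k h, mul_zero, sub_zero])
    refine ⟨P + Polynomial.C a * Polynomial.X ^ (n + 1), ?_, ?_, fun x => ?_⟩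
    · rw [Polynomial.degree_lt_iff_coeff_zero] at hP ⊢
      intro k hk
      rw [Polynomial.coeff_add, hP k (by omega), Polynomial.coeff_C_mul, Polynomial.coeff_X_pow,
        if_neg (by omega)]
      simp
    · intro j hj
      obtain rfl : n = j := by omega
      rw [Polynomial.degree_lt_iff_coeff_zero] at hP
      rw [Polynomial.coeff_add, hP (n + 1) le_rfl]
      simp [ha]
    · have := hPe x
      simp only [hD, Polynomial.eval_sub, Polynomial.eval_mul, Polynomial.eval_C, Polynomial.eval_pow,
        Polynomial.eval_X, Polynomial.eval_add] at this ⊢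
      rw [← sub_eq_add_neg] at this
      linear_combination this

/-- If the differences `g t - g (t - c)` are given by a periodic family of polynomials, so is `g`. -/
theorem AgreesWithQuasi.of_sub {d : ℕ} {e : ℚ} {N : ℤ} {f g : ℤ → ℚ}
    (h : AgreesWithQuasi d e N f) {c : ℕ} (hc : 0 < c)
    (hg : ∀ t, N ≤ t → g t - g (t - c) = f t) :
    AgreesWithQuasi (d + 1) (e / ((d + 1 : ℕ) * c)) N g := by
  obtain ⟨q, hq, p, hp, hd, hf⟩ := h
  -- Summing `q` differences of step `c` gives a difference of step `Q`, a multiple of the period.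
  -- Along a residue class mod `Q` the right-hand side is then a single polynomial.
  set Q : ℕ := q * c with hQ
  have hQ0 : 0 < Q := Nat.mul_pos hq hc
  have hQq : (Q : ℚ) ≠ 0 := by positivity
  have hpQ : Function.Periodic p (Q : ℤ) := by
    intro t
    have := hp.nat_mul c t
    rw [hQ]; push_cast
    rw [mul_comm]; exact this
  set s : ℤ → Polynomial ℚ := fun t => ∑ i ∈ Finset.range q,
    (p (t - i * c)).comp (Polynomial.X - Polynomial.C ((i : ℚ) * c)) with hs
  have hsQ : Function.Periodic s (Q : ℤ) := by
    intro t
    simp only [hs]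
    refine Finset.sum_congr rfl fun i _ => ?_
    rw [show t + (Q : ℤ) - i * c = (t - i * c) + Q by ring, hpQ]
  have hsd : ∀ t, (s t).degree < (d + 1 : ℕ) := by
    intro t
    refine Polynomial.degree_lt_iff_coeff_zero _ _ |>.2 fun k hk => ?_
    rw [hs, Polynomial.finsetSum_coeff]
    refine Finset.sum_eq_zero fun i _ => Polynomial.coeff_eq_zero_of_natDegree_lt ?_
    exact (natDegree_comp_X_sub_C_le (hd _).1 _).trans_lt (by omega)
  have hsc : ∀ t, (s t).coeff d = q * e := by
    intro t
    rw [hs, Polynomial.finsetSum_coeff]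
    simp only [coeff_comp_X_sub_C (hd _).1, (hd _).2]
    simp
  have hiter : ∀ n : ℕ, ∀ t, N + n * c ≤ t + c →
      g t - g (t - n * c) = ∑ i ∈ Finset.range n, f (t - i * c) := by
    intro n
    induction n with
    | zero => intro t _; simp
    | succ n ih =>
      intro t ht
      push_cast at ht
      rw [Finset.sum_range_succ, ← ih t (by nlinarith), ← hg (t - n * c) (by linarith)]
      rw [show t - ((n + 1 : ℕ) : ℤ) * c = t - n * c - c by push_cast; ring]
      ring
  have hgs : ∀ t, N + Q ≤ t → g t - g (t - Q) = (s t).eval (t : ℚ) := by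
    intro t ht
    have h1 := hiter q t (by rw [hQ] at ht; push_cast at ht; linarith)
    rw [hQ]; push_cast
    rw [h1, hs, Polynomial.eval_finsetSum]
    refine Finset.sum_congr rfl fun i hi => ?_
    rw [hf]
    · simp
    · have : (i : ℤ) * c ≤ q * c := by
        have := (Finset.mem_range.1 hi).le
        gcongr
      rw [hQ] at ht; push_cast at ht; linarith
  choose! A hA hAc hAe using fun (P : Polynomial ℚ) (hP : P.degree < (d + 1 : ℕ)) =>
    exists_eval_sub_eval_sub_eq hQq (d + 1) P hP
  -- What remains after removing the antiderivative is `Q`-periodic from `N` on. It is therefore a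
  -- periodic constant term, determined by the block `[N, N + Q)`, and the threshold `N` does not
  -- grow.
  set u : ℤ → ℚ := fun t => g t - (A (s t)).eval (t : ℚ) with hu
  have huQ : ∀ n : ℕ, ∀ t, N ≤ t → u (t + n * Q) = u t := by
    intro n
    induction n with
    | zero => intro t _; simp
    | succ n ih =>
      intro t ht
      have e1 : t + ((n + 1 : ℕ) : ℤ) * Q = (t + n * Q) + Q := by push_cast; ring
      rw [← ih t ht, e1]
      have h0 : 0 ≤ (n : ℤ) * Q := by positivity
      have h1 := hgs (t + n * Q + Q) (by linarith)
      rw [add_sub_cancel_right, hsQ] at h1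
      have h2 := hAe (s (t + n * Q)) (hsd _) ((t + n * Q + Q : ℤ) : ℚ)
      rw [show (((t + n * Q + Q : ℤ) : ℚ) - Q) = ((t + n * Q : ℤ) : ℚ) by push_cast; ring] at h2
      simp only [hu]
      rw [hsQ]
      linarith
  refine ⟨Q, hQ0, fun t => A (s t) + Polynomial.C (u (N + (t - N) % Q)), fun t => ?_,
    fun t => ⟨?_, ?_⟩, fun t ht => ?_⟩
  · simp only
    rw [hsQ, show t + (Q : ℤ) - N = t - N + Q by ring, Int.add_emod_right]
  · refine Polynomial.natDegree_add_le_of_degree_le ?_ (by simp)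
    exact Polynomial.natDegree_le_iff_coeff_eq_zero.2 fun k hk =>
      (Polynomial.degree_lt_iff_coeff_zero _ _).1 (hA _ (hsd t)) k hk
  · rw [Polynomial.coeff_add, hAc _ (hsd t) d rfl, hsc, Polynomial.coeff_C, if_neg (by omega),
      add_zero, hQ]
    push_cast
    field_simp
  · have hQ' : (0 : ℤ) < Q := by exact_mod_cast hQ0
    have h1 : N ≤ N + (t - N) % Q := by
      have := Int.emod_nonneg (t - N) hQ'.ne'
      linarith
    have h2 : 0 ≤ (t - N) / Q := Int.ediv_nonneg (by linarith) hQ'.le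
    obtain ⟨n, hn⟩ := Int.eq_ofNat_of_zero_le h2
    have h3 := huQ n _ h1
    have h4 : N + (t - N) % Q + n * Q = t := by
      have := Int.emod_add_mul_ediv (t - N) Q
      rw [hn] at this
      linarith
    rw [h4] at h3
    rw [Polynomial.eval_add, Polynomial.eval_C, ← h3, hu]
    ring

/-! ### Comparison of functions through their values at large integers -/

namespace AgreesWithQuasi

theorem coeff_le_of_eventually_le {d : ℕ} {e e' : ℚ} {N : ℤ} {f f' : ℤ → ℚ}
    (h : AgreesWithQuasi d e N f) (h' : AgreesWithQuasi d e' N f')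
    (hle : ∀ᶠ r : ℕ in atTop, f r ≤ f' r) : e ≤ e' := by
  have hdiff := h'.add (h.const_mul (-1))
  obtain ⟨q, hq, p, hp, hd, hf⟩ := hdiff
  by_contra hlt
  have he : (p 0).coeff d < 0 := by rw [(hd 0).2]; linarith
  have hnd : (p 0).natDegree = d :=
    le_antisymm (hd 0).1 (Polynomial.le_natDegree_of_ne_zero he.ne)
  have hneg : ∀ᶠ x : ℚ in atTop, (p 0).eval x < 0 := by
    rcases Nat.eq_zero_or_pos d with rfl | hpos
    · rw [Polynomial.eq_C_of_natDegree_eq_zero hnd]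
      simpa using ⟨0, fun _ _ => he⟩
    · refine ((p 0).tendsto_atBot_of_leadingCoeff_nonpos
        (Polynomial.natDegree_pos_iff_degree_pos.1 (hnd ▸ hpos)) ?_).eventually_lt_atBot 0
      rw [Polynomial.leadingCoeff, hnd]
      exact he.le
  have hN : ∀ᶠ r : ℕ in atTop, N ≤ (r : ℤ) :=
    tendsto_natCast_atTop_atTop.eventually_ge_atTop N
  -- Along multiples of the period the family reduces to the one polynomial `p 0`, which would be
  -- eventually negative.
  have hmul : Tendsto (fun k : ℕ => k * q) atTop atTop := tendsto_id.atTop_mul_const' hq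
  have hcast : Tendsto (fun k : ℕ => ((k * q : ℕ) : ℚ)) atTop atTop :=
    tendsto_natCast_atTop_atTop.comp hmul
  obtain ⟨k, h1, h2, h3⟩ :=
    ((hcast.eventually hneg).and ((hmul.eventually hN).and (hmul.eventually hle))).exists
  have h4 := hf _ h2
  have h5 : p ((k * q : ℕ) : ℤ) = p 0 := by
    have := hp.nat_mul k 0
    simpa using this
  rw [h5, Int.cast_natCast] at h4
  linarith

/-- Each `p t` vanishes at infinitely many points of the residue class of `t`, so vanishing at large
integers propagates down to the threshold `N`. Since quasi-polynomials have no threshold, this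
yields identities on all of `ℤ`. -/
theorem eq_zero_of_eventually {d : ℕ} {e : ℚ} {N : ℤ} {f : ℤ → ℚ}
    (h : AgreesWithQuasi d e N f) (h0 : ∀ᶠ r : ℕ in atTop, f r = 0) {t : ℤ} (ht : N ≤ t) :
    f t = 0 := by
  obtain ⟨q, hq, p, hp, hd, hf⟩ := h
  suffices hpt : p t = 0 by rw [hf t ht, hpt, Polynomial.eval_zero]
  obtain ⟨M, hM⟩ := eventually_atTop.1 h0
  -- The extra `M + |t|` periods make every sample point at least `M`.
  refine Polynomial.eq_zero_of_infinite_isRoot _ (Set.Infinite.mono (s := Set.range fun n : ℕ =>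
    ((t + (n + (M + t.natAbs) : ℕ) * q : ℤ) : ℚ)) ?_ (Set.infinite_range_of_injective ?_))
  · rintro _ ⟨n, rfl⟩
    set k := n + (M + t.natAbs) with hk
    have hq1 : (k : ℤ) ≤ k * q := by
      have : (1 : ℤ) ≤ q := by exact_mod_cast hq
      nlinarith [Int.natCast_nonneg k]
    have hpk : p (t + k * q) = p t := by
      have := hp.nat_mul k t
      simpa using this
    have h1 : N ≤ t + k * q := by
      have : (0 : ℤ) ≤ k := Int.natCast_nonneg k
      linarith
    have h2 : (M : ℤ) ≤ t + k * q := by omega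
    obtain ⟨r, hr⟩ := Int.eq_ofNat_of_zero_le ((Int.natCast_nonneg M).trans h2)
    have h3 := hf _ h1
    rw [hpk, hr, hM r (by omega)] at h3
    change Polynomial.eval ((t + k * q : ℤ) : ℚ) _ = 0
    rw [hr, ← h3]
  · intro n n' hn
    have hq' : (q : ℤ) ≠ 0 := by exact_mod_cast hq.ne'
    simp only [Int.cast_inj, add_right_inj, mul_left_inj' hq', Nat.cast_inj, add_left_inj] at hn
    exact hn

end AgreesWithQuasi

/-! ### Quasi-polynomials as periodic families of polynomials -/

/-- The polynomial obtained from `Φ` by evaluating its coefficients at `t`. -/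
noncomputable def fiber (Φ : QuasiPolynomial) (t : ℤ) : Polynomial ℚ :=
  Φ.map ((Pi.evalRingHom (fun _ : ℤ => ℚ) t).comp
    (periodicNumber.val : periodicNumber →+* (ℤ → ℚ)))

theorem coeff_fiber (Φ : QuasiPolynomial) (t : ℤ) (i : ℕ) :
    (fiber Φ t).coeff i = (Φ.coeff i : ℤ → ℚ) t := by
  simp [fiber]

theorem evalAt_eq_eval_fiber (Φ : QuasiPolynomial) (t : ℤ) :
    evalAt Φ t = (fiber Φ t).eval (t : ℚ) :=
  Polynomial.eval₂_eq_eval_map _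

theorem evalAt_sub (Φ Ψ : QuasiPolynomial) (t : ℤ) :
    evalAt (Φ - Ψ) t = evalAt Φ t - evalAt Ψ t :=
  Polynomial.eval₂_sub _

theorem exists_periodic_fiber (Φ : QuasiPolynomial) :
    ∃ q : ℕ, 0 < q ∧ Function.Periodic (fiber Φ) (q : ℤ) := by
  suffices h : ∀ n : ℕ, ∃ q : ℕ, 0 < q ∧
      ∀ i < n, Function.Periodic (Φ.coeff i : ℤ → ℚ) (q : ℤ) by
    obtain ⟨q, hq, h⟩ := h (Φ.natDegree + 1)
    refine ⟨q, hq, fun t => ?_⟩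
    ext i
    rw [coeff_fiber, coeff_fiber]
    by_cases hi : i < Φ.natDegree + 1
    · exact h i hi t
    · rw [Polynomial.coeff_eq_zero_of_natDegree_lt (by omega)]
      rfl
  intro n
  induction n with
  | zero => exact ⟨1, one_pos, by simp⟩
  | succ n ih =>
    obtain ⟨q, hq, h⟩ := ih
    obtain ⟨q', hq', h'⟩ := (Φ.coeff n).2
    refine ⟨q * q', Nat.mul_pos hq hq', fun i hi t => ?_⟩
    rcases Nat.lt_succ_iff_lt_or_eq.1 hi with hi | rfl
    · have := (h i hi).nat_mul q' t
      push_cast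
      rwa [mul_comm] at this
    · have := h'.nat_mul q t
      push_cast
      exact this

/-- The degree bound is strict because the leading coefficient of `Φ` need not be constant, whereas
the coefficient above it is `0`. -/
theorem agreesWithQuasi_evalAt (Φ : QuasiPolynomial) {d : ℕ} (hd : Φ.natDegree < d) (N : ℤ) :
    AgreesWithQuasi d 0 N (evalAt Φ) := by
  obtain ⟨q, hq, hp⟩ := exists_periodic_fiber Φ
  have hdeg : ∀ t, (fiber Φ t).natDegree < d := fun t =>
    (Polynomial.natDegree_map_le).trans_lt hd
  exact ⟨q, hq, fiber Φ, hp, fun t => ⟨(hdeg t).le,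
    Polynomial.coeff_eq_zero_of_natDegree_lt (hdeg t)⟩, fun t _ => evalAt_eq_eval_fiber Φ t⟩

theorem QuasiPolynomial.ext_of_eventually {Φ Ψ : QuasiPolynomial}
    (h : ∀ᶠ r : ℕ in atTop, evalAt Φ r = evalAt Ψ r) : Φ = Ψ := by
  rw [← sub_eq_zero]
  set Θ := Φ - Ψ
  have hΘ : ∀ t, evalAt Θ t = 0 := fun t =>
    (agreesWithQuasi_evalAt Θ (Nat.lt_succ_self _) t).eq_zero_of_eventually
      (h.mono fun r hr => by rw [evalAt_sub, hr, sub_self]) le_rfl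
  obtain ⟨q, hq, hp⟩ := exists_periodic_fiber Θ
  have hfib : ∀ t, fiber Θ t = 0 := by
    intro t
    refine Polynomial.eq_zero_of_infinite_isRoot _ (Set.Infinite.mono (s := Set.range fun n : ℕ =>
      ((t + n * q : ℤ) : ℚ)) ?_ (Set.infinite_range_of_injective ?_))
    · rintro _ ⟨n, rfl⟩
      have hpn : fiber Θ (t + n * q) = fiber Θ t := hp.nat_mul n t
      change Polynomial.eval _ _ = 0
      rw [← hpn, ← evalAt_eq_eval_fiber, hΘ]
    · intro n n' hn
      have hq' : (q : ℤ) ≠ 0 := by exact_mod_cast hq.ne'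
      simp only [Int.cast_inj, add_right_inj, mul_left_inj' hq', Nat.cast_inj] at hn
      exact hn
  ext i t
  rw [← coeff_fiber, hfib]
  rfl

/-- A function agreeing with a periodic family of polynomials is given by a quasi-polynomial. -/
theorem AgreesWithQuasi.exists_quasiPolynomial {d : ℕ} {e : ℚ} {N : ℤ} {f : ℤ → ℚ}
    (h : AgreesWithQuasi d e N f) : ∃ Φ : QuasiPolynomial, Φ.degree ≤ (d : WithBot ℕ) ∧
      Φ.coeff d = algebraMap ℚ periodicNumber e ∧ ∀ t, N ≤ t → evalAt Φ t = f t := by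
  obtain ⟨q, hq, p, hp, hd, hf⟩ := h
  set c : ℕ → periodicNumber := fun i => ⟨fun t => (p t).coeff i, q, hq, fun t => by simp [hp t]⟩
    with hc
  set Φ : QuasiPolynomial := ∑ i ∈ Finset.range (d + 1), Polynomial.monomial i (c i) with hΦ
  have hcoeff : ∀ i, Φ.coeff i = if i ≤ d then c i else 0 := by
    intro i
    rw [hΦ, Polynomial.finsetSum_coeff]
    simp [Polynomial.coeff_monomial]
  have hfib : ∀ t, fiber Φ t = p t := by
    intro t
    ext i
    rw [coeff_fiber, hcoeff]
    split_ifs with hi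
    · rfl
    · rw [Polynomial.coeff_eq_zero_of_natDegree_lt ((hd t).1.trans_lt (not_le.1 hi))]
      rfl
  refine ⟨Φ, ?_, ?_, fun t ht => by rw [evalAt_eq_eval_fiber, hfib, hf t ht]⟩
  · rw [Polynomial.degree_le_iff_coeff_zero]
    intro i hi
    rw [hcoeff, if_neg (not_le.2 (by exact_mod_cast hi))]
  · ext t
    rw [← coeff_fiber, hfib, (hd t).2]
    rfl

/-! ### Alternating sums of shifts of a function -/

/-- `f` is a finite sum of functions `± g(t - c)` with `c : ℕ`. -/
def IsAltSum (g f : ℤ → ℚ) : Prop :=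
  ∃ (N : ℕ) (ε : Fin N → ℤˣ) (c : Fin N → ℕ),
    ∀ t : ℤ, f t = ∑ i, ((ε i : ℤ) : ℚ) * g (t - (c i : ℤ))

namespace IsAltSum

variable {g f f' : ℤ → ℚ}

theorem refl (g : ℤ → ℚ) : IsAltSum g g :=
  ⟨1, fun _ => 1, fun _ => 0, fun t => by simp⟩

theorem zero (g : ℤ → ℚ) : IsAltSum g (fun _ => 0) :=
  ⟨0, fun _ => 1, fun _ => 0, fun t => by simp⟩

theorem add (h : IsAltSum g f) (h' : IsAltSum g f') : IsAltSum g (fun t => f t + f' t) := by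
  obtain ⟨N, ε, c, h⟩ := h
  obtain ⟨N', ε', c', h'⟩ := h'
  refine ⟨N + N', Fin.append ε ε', Fin.append c c', fun t => ?_⟩
  simp only [Fin.sum_univ_add, Fin.append_left, Fin.append_right, h t, h' t]

theorem units_mul (h : IsAltSum g f) (u : ℤˣ) : IsAltSum g (fun t => ((u : ℤ) : ℚ) * f t) := by
  obtain ⟨N, ε, c, h⟩ := h
  refine ⟨N, fun i => u * ε i, c, fun t => ?_⟩
  simp only [h t, Finset.mul_sum, Units.val_mul, Int.cast_mul, mul_assoc]

theorem shift (h : IsAltSum g f) (a : ℕ) : IsAltSum g (fun t => f (t - a)) := by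
  obtain ⟨N, ε, c, h⟩ := h
  refine ⟨N, ε, fun i => a + c i, fun t => ?_⟩
  simp only [h (t - a), Nat.cast_add, sub_sub]

theorem sub (h : IsAltSum g f) (h' : IsAltSum g f') : IsAltSum g (fun t => f t - f' t) := by
  simpa [sub_eq_add_neg] using h.add (h'.units_mul (-1))

theorem sum {ι : Type*} (s : Finset ι) {F : ι → ℤ → ℚ} (h : ∀ i ∈ s, IsAltSum g (F i)) :
    IsAltSum g (fun t => ∑ i ∈ s, F i t) := by
  classical
  induction s using Finset.induction_on with
  | empty => simpa using zero g
  | insert a s ha ih =>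
    simp only [Finset.sum_insert ha]
    exact (h a (Finset.mem_insert_self a s)).add
      (ih fun i hi => h i (Finset.mem_insert_of_mem hi))

theorem trans {g' : ℤ → ℚ} (h : IsAltSum g f) (h' : IsAltSum g' g) : IsAltSum g' f := by
  obtain ⟨N, ε, c, h⟩ := h
  rw [show f = fun t => ∑ i, ((ε i : ℤ) : ℚ) * g (t - (c i : ℤ)) from funext h]
  exact sum _ fun i _ => (h'.shift (c i)).units_mul (ε i)

end IsAltSum

/-! ### Counting the exponents outside an upper set -/

/-- The number of exponent vectors of weighted order at most `r` outside `E`. -/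
noncomputable def countCompl {m : ℕ} (w : Fin m → ℕ) (E : Set (Fin m → ℕ)) (r : ℤ) : ℚ :=
  (Set.ncard {k : Fin m → ℕ | k ∉ E ∧ (weightedOrder w k : ℤ) ≤ r} : ℚ)

theorem finite_weightedOrder_le {m : ℕ} {w : Fin m → ℕ} (hw : ∀ i, 0 < w i) (r : ℤ) :
    {k : Fin m → ℕ | (weightedOrder w k : ℤ) ≤ r}.Finite := by
  refine (Set.finite_Iic (fun _ : Fin m => r.toNat)).subset fun k hk i => ?_
  have h1 : w i * k i ≤ weightedOrder w k :=
    Finset.single_le_sum (f := fun i => w i * k i) (fun _ _ => Nat.zero_le _) (Finset.mem_univ i)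
  have h2 : k i ≤ w i * k i := Nat.le_mul_of_pos_left _ (hw i)
  have hk' : (weightedOrder w k : ℤ) ≤ r := hk
  change k i ≤ r.toNat
  omega

theorem finite_countCompl {m : ℕ} {w : Fin m → ℕ} (hw : ∀ i, 0 < w i) (E : Set (Fin m → ℕ)) (r : ℤ) :
    {k : Fin m → ℕ | k ∉ E ∧ (weightedOrder w k : ℤ) ≤ r}.Finite :=
  (finite_weightedOrder_le hw r).subset fun _ hk => hk.2

theorem countCompl_of_neg {m : ℕ} (w : Fin m → ℕ) (E : Set (Fin m → ℕ)) {r : ℤ} (hr : r < 0) :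
    countCompl w E r = 0 := by
  have : {k : Fin m → ℕ | k ∉ E ∧ (weightedOrder w k : ℤ) ≤ r} = ∅ := by
    ext k
    simp only [Set.mem_ofPred_eq, Set.mem_empty_iff_false, iff_false, not_and, not_le]
    intro _
    omega
  rw [countCompl, this, Set.ncard_empty, Nat.cast_zero]

/-- The part of `E` where the first exponent is zero. -/
def slice {m : ℕ} (E : Set (Fin (m + 1) → ℕ)) : Set (Fin m → ℕ) := {k | Fin.cons 0 k ∈ E}

/-- The exponents which land in `E` when the first one is increased by one. -/
def stepUp {m : ℕ} (E : Set (Fin (m + 1) → ℕ)) : Set (Fin (m + 1) → ℕ) :=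
  {k | Fin.cons (k 0 + 1) (Fin.tail k) ∈ E}

section

variable {m : ℕ} {E : Set (Fin (m + 1) → ℕ)}

theorem isUpperSet_slice (hE : IsUpperSet E) : IsUpperSet (slice E) := fun _ _ hab ha =>
  hE (Fin.cons_le_cons.2 ⟨le_rfl, hab⟩) ha

theorem isUpperSet_stepUp (hE : IsUpperSet E) : IsUpperSet (stepUp E) := fun _ _ hab ha =>
  hE (Fin.cons_le_cons.2 ⟨Nat.succ_le_succ (hab 0), fun i => hab i.succ⟩) ha

theorem subset_stepUp (hE : IsUpperSet E) : E ⊆ stepUp E := fun a ha =>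
  hE (by
    conv_lhs => rw [← Fin.cons_self_tail a]
    exact Fin.cons_le_cons.2 ⟨Nat.le_succ _, le_rfl⟩) ha

theorem weightedOrder_cons (w : Fin (m + 1) → ℕ) (a : ℕ) (k : Fin m → ℕ) :
    weightedOrder w (Fin.cons a k : Fin (m + 1) → ℕ) = w 0 * a + weightedOrder (Fin.tail w) k := by
  simp [weightedOrder, Fin.sum_univ_succ, Fin.tail]

/-- Exponents with positive first entry are lowered by one there, which moves the condition from `E`
to `stepUp E` and the order down by `w 0`. With `r` in `ℤ` no case `r < w 0` is exceptional, since
counts vanish at negative integers. -/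
theorem countCompl_eq_add {w : Fin (m + 1) → ℕ} (hw : ∀ i, 0 < w i) (E : Set (Fin (m + 1) → ℕ))
    (r : ℤ) :
    countCompl w E r = countCompl (Fin.tail w) (slice E) r + countCompl w (stepUp E) (r - w 0) := by
  have hw' : ∀ i, 0 < Fin.tail w i := fun i => hw i.succ
  set f : (Fin m → ℕ) → (Fin (m + 1) → ℕ) := fun k => Fin.cons 0 k with hf
  set g : (Fin (m + 1) → ℕ) → (Fin (m + 1) → ℕ) := fun k => Fin.cons (k 0 + 1) (Fin.tail k) with hg
  have hfi : Function.Injective f := fun a b h => by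
    simpa [hf] using h
  have hgi : Function.Injective g := fun a b h => by
    simp only [hg, Fin.cons_inj, add_left_inj] at h
    rw [← Fin.cons_self_tail a, ← Fin.cons_self_tail b, h.1, h.2]
  have hgw : ∀ k, weightedOrder w (g k) = w 0 + weightedOrder w k := by
    intro k
    conv_rhs => rw [← Fin.cons_self_tail k]
    rw [hg, weightedOrder_cons, weightedOrder_cons]
    ring
  have hset : {k | k ∉ E ∧ (weightedOrder w k : ℤ) ≤ r} =
      f '' {k | k ∉ slice E ∧ (weightedOrder (Fin.tail w) k : ℤ) ≤ r} ∪
      g '' {k | k ∉ stepUp E ∧ (weightedOrder w k : ℤ) ≤ r - w 0} := by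
    ext k
    constructor
    · rintro ⟨h1, h2⟩
      rcases Nat.eq_zero_or_pos (k 0) with h0 | h0
      · have hk : f (Fin.tail k) = k := by
          rw [hf, ← h0]; exact Fin.cons_self_tail k
        refine Or.inl ⟨Fin.tail k, ⟨fun h => h1 (hk ▸ h), ?_⟩, hk⟩
        rw [← hk, hf, weightedOrder_cons] at h2
        simpa using h2
      · set k' : Fin (m + 1) → ℕ := Fin.cons (k 0 - 1) (Fin.tail k) with hk'
        have hk : g k' = k := by
          simp only [hg, hk', Fin.cons_zero, Fin.tail_cons, Nat.sub_add_cancel h0,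
            Fin.cons_self_tail]
        refine Or.inr ⟨k', ⟨fun h => h1 (hk ▸ h), ?_⟩, hk⟩
        rw [← hk, hgw] at h2
        push_cast at h2
        linarith
    · rintro (⟨k', ⟨h1, h2⟩, rfl⟩ | ⟨k', ⟨h1, h2⟩, rfl⟩)
      · refine ⟨h1, ?_⟩
        rw [hf, weightedOrder_cons]
        simpa using h2
      · refine ⟨h1, ?_⟩
        rw [hgw]
        push_cast
        linarith
  have hdisj : Disjoint (f '' {k | k ∉ slice E ∧ (weightedOrder (Fin.tail w) k : ℤ) ≤ r})
      (g '' {k | k ∉ stepUp E ∧ (weightedOrder w k : ℤ) ≤ r - w 0}) := by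
    rw [Set.disjoint_left]
    rintro _ ⟨a, -, rfl⟩ ⟨b, -, h⟩
    have := congrFun h 0
    simp [hf, hg] at this
  rw [countCompl, hset, Set.ncard_union_eq hdisj ((finite_countCompl hw' _ _).image _)
    ((finite_countCompl hw _ _).image _), Set.ncard_image_of_injective _ hfi,
    Set.ncard_image_of_injective _ hgi, countCompl, countCompl, Nat.cast_add]

/-- To prove a property of all upper sets, it is enough to prove it for those stable under `stepUp`
and to descend from `stepUp E` to `E`. -/
theorem IsUpperSet.stepUp_induction {P : Set (Fin (m + 1) → ℕ) → Prop}
    (hstable : ∀ E, IsUpperSet E → stepUp E = E → P E)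
    (hstep : ∀ E, IsUpperSet E → P (stepUp E) → P E) (hE : IsUpperSet E) : P E := by
  have hU : ∀ n, IsUpperSet (stepUp^[n] E) := by
    intro n
    induction n with
    | zero => exact hE
    | succ n ih =>
      rw [Function.iterate_succ_apply']
      exact isUpperSet_stepUp ih
  have hmono : Monotone fun n => stepUp^[n] E := monotone_nat_of_le_succ fun n => by
    rw [Function.iterate_succ_apply']
    exact subset_stepUp (hU n)
  -- Dickson's lemma: if the increasing chain never stabilised, pick an element `k n` new at each
  -- step. Some `i < j` has `k i ≤ k j`, which already places `k j` in the `j`-th set.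
  obtain ⟨n, hn⟩ : ∃ n, stepUp (stepUp^[n] E) = stepUp^[n] E := by
    by_contra! hne
    have hex : ∀ n, ∃ k, k ∈ stepUp (stepUp^[n] E) ∧ k ∉ stepUp^[n] E := fun n => by
      by_contra! h
      exact hne n (Set.Subset.antisymm h (subset_stepUp (hU n)))
    choose k hk hk' using hex
    obtain ⟨i, j, hij, hle⟩ := wellQuasiOrdered_le k
    have h1 : k i ∈ stepUp^[i + 1] E := by
      rw [Function.iterate_succ_apply']
      exact hk i
    exact hk' j (hU j hle (hmono (Nat.succ_le_of_lt hij) h1))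
  have hP : ∀ j ≤ n, P (stepUp^[n - j] E) := by
    intro j
    induction j with
    | zero => intro _; exact hstable _ (hU n) hn
    | succ j ih =>
      intro hj
      refine hstep _ (hU _) ?_
      rw [← Function.iterate_succ_apply' stepUp, show (n - (j + 1)).succ = n - j by omega]
      exact ih (by omega)
  simpa using hP n le_rfl

/-- Membership in a stable set does not depend on the first exponent, which can be lowered to `0`.
-/
theorem slice_nonempty_of_stable (hstable : stepUp E = E) (hne : E.Nonempty) :
    (slice E).Nonempty := by
  obtain ⟨k, hk⟩ := hne
  have h : ∀ a : ℕ, (Fin.cons a (Fin.tail k) : Fin (m + 1) → ℕ) ∈ E →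
      (Fin.cons 0 (Fin.tail k) : Fin (m + 1) → ℕ) ∈ E := by
    intro a
    induction a with
    | zero => exact id
    | succ a ih =>
      intro ha
      refine ih ?_
      rw [← hstable]
      simpa [stepUp] using ha
  exact ⟨Fin.tail k, h (k 0) (by rwa [Fin.cons_self_tail])⟩

end

/-! ### Dimension zero and the asymptotics of the counts -/

theorem countCompl_fin_zero (w : Fin 0 → ℕ) (E : Set (Fin 0 → ℕ)) {r : ℤ} (hr : 0 ≤ r)
    (hE : E = ∅) : countCompl w E r = 1 := by
  have : {k : Fin 0 → ℕ | k ∉ E ∧ (weightedOrder w k : ℤ) ≤ r} = {0} := by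
    ext k
    simp [hE, weightedOrder, hr, Subsingleton.elim k 0]
  rw [countCompl, this, Set.ncard_singleton, Nat.cast_one]

theorem countCompl_fin_zero_of_nonempty (w : Fin 0 → ℕ) {E : Set (Fin 0 → ℕ)} (hE : E.Nonempty) :
    countCompl w E = fun _ => 0 := by
  funext r
  obtain ⟨k, hk⟩ := hE
  have : {k : Fin 0 → ℕ | k ∉ E ∧ (weightedOrder w k : ℤ) ≤ r} = ∅ := by
    ext l
    rw [Subsingleton.elim l k]
    simp [hk]
  rw [countCompl, this, Set.ncard_empty, Nat.cast_zero]

theorem agreesWithQuasi_countCompl_fin_zero (w : Fin 0 → ℕ) :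
    AgreesWithQuasi 0 1 0 (countCompl w ∅) :=
  ⟨1, one_pos, fun _ => 1, fun _ => rfl, by simp,
    fun t ht => by simp [countCompl_fin_zero w ∅ ht rfl]⟩

theorem agreesWithQuasi_countCompl_empty {m : ℕ} {w : Fin m → ℕ} (hw : ∀ i, 0 < w i) :
    AgreesWithQuasi m (1 / ((m ! : ℚ) * ∏ i, (w i : ℚ))) 0 (countCompl w ∅) := by
  induction m with
  | zero => simpa using agreesWithQuasi_countCompl_fin_zero w
  | succ m ih =>
    -- `slice ∅` and `stepUp ∅` are both `∅`, so the `w 0`-difference is the count in one dimension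
    -- less. Summation divides the top coefficient by `(m + 1) w 0`.
    have h := (ih (w := Fin.tail w) fun i => hw i.succ).of_sub (hw 0)
      (g := countCompl w ∅) fun t _ => by
        rw [countCompl_eq_add hw ∅ t]
        exact add_sub_cancel_right _ _
    convert h using 1
    rw [Fin.prod_univ_succ, Nat.factorial_succ]
    simp only [Fin.tail]
    push_cast
    field_simp

/-- The coefficient of order `m` of the count of the complement of a nonempty upper set is `0`. -/
theorem agreesWithQuasi_countCompl_of_nonempty {m : ℕ} {w : Fin m → ℕ} (hw : ∀ i, 0 < w i)
    {E : Set (Fin m → ℕ)} (hE : IsUpperSet E) (hne : E.Nonempty) :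
    ∃ N, AgreesWithQuasi m 0 N (countCompl w E) := by
  induction m with
  | zero =>
    rw [countCompl_fin_zero_of_nonempty w hne]
    exact ⟨0, .zero 0 0⟩
  | succ m ih =>
    have hw' : ∀ i, 0 < Fin.tail w i := fun i => hw i.succ
    revert hne
    refine IsUpperSet.stepUp_induction (P := fun E => E.Nonempty →
      ∃ N, AgreesWithQuasi (m + 1) 0 N (countCompl w E)) ?_ ?_ hE
    · intro E hE hstable hne
      obtain ⟨N, hN⟩ := ih hw' (isUpperSet_slice hE) (slice_nonempty_of_stable hstable hne)
      refine ⟨N, ?_⟩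
      have h := hN.of_sub (hw 0) (g := countCompl w E) fun t _ => by
        conv_lhs => rw [countCompl_eq_add hw E t, hstable]
        exact add_sub_cancel_right _ _
      simpa using h
    · intro E hE hP hne
      obtain ⟨N, hN⟩ := hP (hne.mono (subset_stepUp hE))
      obtain ⟨M, e, hM⟩ : ∃ M e, AgreesWithQuasi m e M (countCompl (Fin.tail w) (slice E)) := by
        rcases (slice E).eq_empty_or_nonempty with h | h
        · rw [h]
          exact ⟨_, _, agreesWithQuasi_countCompl_empty hw'⟩
        · obtain ⟨M, hM⟩ := ih hw' (isUpperSet_slice hE) h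
          exact ⟨M, 0, hM⟩
      refine ⟨max M (N + w 0), ?_⟩
      rw [show countCompl w E = _ from funext (countCompl_eq_add hw E)]
      simpa using ((hM.lift (Nat.lt_succ_self m)).mono (le_max_left _ _)).add
        ((hN.shift (w 0)).mono (le_max_right _ _))

/-- `f` vanishes, or agrees with a quasi-polynomial with constant positive leading coefficient. -/
def HasPosLeading (f : ℤ → ℚ) : Prop :=
  f = (fun _ => 0) ∨ ∃ d, ∃ e > 0, ∃ N, AgreesWithQuasi d e N f

/-- Positivity prevents the top terms from cancelling when the degrees are equal. -/
theorem HasPosLeading.add {f g : ℤ → ℚ} (hf : HasPosLeading f) (hg : HasPosLeading g) :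
    HasPosLeading (fun t => f t + g t) := by
  rcases hf with rfl | ⟨d, e, he, N, hf⟩
  · simpa using hg
  rcases hg with rfl | ⟨d', e', he', N', hg⟩
  · right
    simpa using ⟨d, e, he, N, hf⟩
  right
  have hf' := hf.mono (le_max_left N N')
  have hg' := hg.mono (le_max_right N N')
  rcases lt_trichotomy d d' with h | rfl | h
  · exact ⟨d', 0 + e', by linarith, _, (hf'.lift h).add hg'⟩
  · exact ⟨d, e + e', by linarith, _, hf'.add hg'⟩
  · exact ⟨d, e + 0, by linarith, _, hf'.add (hg'.lift h)⟩

theorem HasPosLeading.shift {f : ℤ → ℚ} (hf : HasPosLeading f) (c : ℤ) :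
    HasPosLeading (fun t => f (t - c)) := by
  rcases hf with rfl | ⟨d, e, he, N, hf⟩
  · exact Or.inl rfl
  · exact Or.inr ⟨d, e, he, _, hf.shift c⟩

theorem HasPosLeading.sum {ι : Type*} (s : Finset ι) {F : ι → ℤ → ℚ}
    (h : ∀ i ∈ s, HasPosLeading (F i)) : HasPosLeading (fun t => ∑ i ∈ s, F i t) := by
  classical
  induction s using Finset.induction_on with
  | empty => exact Or.inl (by simp)
  | insert a s ha ih =>
    simp only [Finset.sum_insert ha]
    exact (h a (Finset.mem_insert_self a s)).add
      (ih fun i hi => h i (Finset.mem_insert_of_mem hi))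

/-- A function vanishing at negative integers and invariant under a positive shift vanishes. -/
theorem eq_zero_of_sub_eq {g : ℤ → ℚ} {c : ℕ} (hc : 0 < c) (hneg : ∀ t < 0, g t = 0)
    (hg : ∀ t, g t = g (t - c)) (t : ℤ) : g t = 0 := by
  have h : ∀ n : ℕ, ∀ t < (n : ℤ), g t = 0 := by
    intro n
    induction n with
    | zero => simpa using hneg
    | succ n ih =>
      intro t ht
      rw [hg]
      exact ih _ (by push_cast at ht; omega)
  exact h (t.natAbs + 1) t (by omega)

/-- This controls the actual degree, which may be less than `m`: the recursion uses only sums,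
shifts and discrete summation, all of which preserve a constant positive leading coefficient. -/
theorem hasPosLeading_countCompl {m : ℕ} {w : Fin m → ℕ} (hw : ∀ i, 0 < w i)
    {E : Set (Fin m → ℕ)} (hE : IsUpperSet E) : HasPosLeading (countCompl w E) := by
  induction m with
  | zero =>
    rcases E.eq_empty_or_nonempty with rfl | hne
    · exact Or.inr ⟨0, 1, one_pos, 0, agreesWithQuasi_countCompl_fin_zero w⟩
    · exact Or.inl (countCompl_fin_zero_of_nonempty w hne)
  | succ m ih =>
    have hw' : ∀ i, 0 < Fin.tail w i := fun i => hw i.succ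
    refine IsUpperSet.stepUp_induction (P := fun E => HasPosLeading (countCompl w E)) ?_ ?_ hE
    · intro E hE hstable
      have hrec : ∀ t, countCompl w E t =
          countCompl (Fin.tail w) (slice E) t + countCompl w E (t - w 0) := fun t => by
        conv_lhs => rw [countCompl_eq_add hw E t, hstable]
      rcases ih hw' (isUpperSet_slice hE) with h0 | ⟨d, e, he, N, hN⟩
      · left
        funext t
        refine eq_zero_of_sub_eq (hw 0) (fun t ht => countCompl_of_neg w E ht) (fun t => ?_) t
        conv_lhs => rw [hrec, h0, zero_add]
      · right
        have hw0 := hw 0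
        exact ⟨_, _, by positivity, N, hN.of_sub hw0 (g := countCompl w E) fun t _ => by
          linarith [hrec t]⟩
    · intro E hE hP
      rw [show countCompl w E = _ from funext (countCompl_eq_add hw E)]
      exact (ih hw' (isUpperSet_slice hE)).add (hP.shift (w 0))

/-- The count of the lower-dimensional orthant is the full count minus its shift by `w 0`, so
lower-dimensional terms can be rewritten in dimension `m + 1`. -/
theorem isAltSum_countCompl {m : ℕ} {w : Fin m → ℕ} (hw : ∀ i, 0 < w i)
    {E : Set (Fin m → ℕ)} (hE : IsUpperSet E) :
    IsAltSum (countCompl w ∅) (countCompl w E) := by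
  induction m with
  | zero =>
    rcases E.eq_empty_or_nonempty with rfl | hne
    · exact .refl _
    · rw [countCompl_fin_zero_of_nonempty w hne]
      exact .zero _
  | succ m ih =>
    have hw' : ∀ i, 0 < Fin.tail w i := fun i => hw i.succ
    have hempty : ∀ t, countCompl w ∅ t =
        countCompl (Fin.tail w) ∅ t + countCompl w ∅ (t - w 0) := countCompl_eq_add hw ∅
    have htail : IsAltSum (countCompl w ∅) (countCompl (Fin.tail w) ∅) := by
      rw [show countCompl (Fin.tail w) ∅ = fun t => countCompl w ∅ t - countCompl w ∅ (t - w 0) from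
        funext fun t => by linarith [hempty t]]
      exact (IsAltSum.refl _).sub ((IsAltSum.refl _).shift (w 0))
    refine IsUpperSet.stepUp_induction
      (P := fun E => IsAltSum (countCompl w ∅) (countCompl w E)) ?_ ?_ hE
    · intro E hE hstable
      have hrec : ∀ t, countCompl w E t =
          countCompl (Fin.tail w) (slice E) t + countCompl w E (t - w 0) := fun t => by
        conv_lhs => rw [countCompl_eq_add hw E t, hstable]
      obtain ⟨N, ε, c, h⟩ := ih hw' (isUpperSet_slice hE)
      -- For stable `E` the signs and shifts of the slice work unchanged: the discrepancy is
      -- invariant under the shift by `w 0` and vanishes at negative integers.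
      refine ⟨N, ε, c, fun t => sub_eq_zero.1 (eq_zero_of_sub_eq (g := fun t => countCompl w E t -
        ∑ i, ((ε i : ℤ) : ℚ) * countCompl w ∅ (t - c i)) (hw 0) (fun t ht => ?_)
        (fun t => ?_) t)⟩
      · rw [countCompl_of_neg w E ht, Finset.sum_eq_zero, sub_zero]
        intro i _
        rw [countCompl_of_neg w ∅ (by omega), mul_zero]
      · have h1 : ∑ i, ((ε i : ℤ) : ℚ) * countCompl w ∅ (t - c i) =
            ∑ i, ((ε i : ℤ) : ℚ) * countCompl (Fin.tail w) ∅ (t - c i) +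
            ∑ i, ((ε i : ℤ) : ℚ) * countCompl w ∅ (t - w 0 - c i) := by
          rw [← Finset.sum_add_distrib]
          refine Finset.sum_congr rfl fun i _ => ?_
          rw [hempty, mul_add, sub_right_comm]
        rw [h1, ← h t]
        linarith [hrec t]
    · intro E hE hP
      rw [show countCompl w E = _ from funext (countCompl_eq_add hw E)]
      exact ((ih hw' (isUpperSet_slice hE)).trans htail).add (hP.shift (w 0))

/-! ### The Ehrhart quasi-polynomial of a conic polytope -/

theorem latticeCount_conicPolytope {m : ℕ} (w : Fin m → ℕ) {r : ℕ} (hr : 1 ≤ r) :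
    (latticeCount (conicPolytope w) r : ℚ) = countCompl w ∅ r := by
  have hr0 : (0 : ℝ) < r := by exact_mod_cast hr
  have hmem : ∀ x : Fin m → ℝ, x ∈ (r : ℝ) • conicPolytope w ↔
      (∀ j, 0 ≤ x j) ∧ ∑ i, (w i : ℝ) * x i ≤ r := by
    intro x
    rw [Set.mem_smul_set_iff_inv_smul_mem₀ hr0.ne']
    simp only [conicPolytope, Set.mem_ofPred_eq, Pi.smul_apply, smul_eq_mul]
    refine and_congr (forall_congr' fun j => ?_) ?_
    · rw [mul_nonneg_iff_of_pos_left (inv_pos.2 hr0)]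
    · have : ∑ i, (w i : ℝ) * ((r : ℝ)⁻¹ * x i) = (r : ℝ)⁻¹ * ∑ i, (w i : ℝ) * x i := by
        rw [Finset.mul_sum]
        exact Finset.sum_congr rfl fun i _ => by ring
      rw [this, inv_mul_le_iff₀ hr0, mul_one]
  have hsum : ∀ k : Fin m → ℕ, ∑ i, (w i : ℝ) * ((k i : ℤ) : ℝ) = (weightedOrder w k : ℝ) := by
    intro k
    simp [weightedOrder]
  have hset : {z : Fin m → ℤ | (fun i => (z i : ℝ)) ∈ (r : ℝ) • conicPolytope w} =
      (fun (k : Fin m → ℕ) i => (k i : ℤ)) ''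
        {k : Fin m → ℕ | k ∉ (∅ : Set (Fin m → ℕ)) ∧ (weightedOrder w k : ℤ) ≤ (r : ℤ)} := by
    ext z
    rw [Set.mem_ofPred_eq, hmem]
    constructor
    · rintro ⟨h1, h2⟩
      have hz : (fun i => (((z i).toNat : ℕ) : ℤ)) = z :=
        funext fun i => Int.toNat_of_nonneg (by exact_mod_cast h1 i)
      refine ⟨fun i => (z i).toNat, ⟨fun h => h, ?_⟩, hz⟩
      rw [← hz, hsum] at h2
      exact_mod_cast h2
    · rintro ⟨k, ⟨-, h⟩, rfl⟩
      refine ⟨fun j => by positivity, ?_⟩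
      rw [hsum]
      exact_mod_cast h
  rw [latticeCount, hset, Set.ncard_image_of_injective, countCompl]
  intro a b h
  funext i
  exact Int.natCast_inj.1 (congrFun h i)

/-! ### Algebraic dependence -/

section Algebraic

variable {K L : Type*} [Field K] [Field L] [Algebra K L]

/-- `ψ` will be a transform, which moves the elements of `K` inside `K` and so is not `K`-linear. -/
theorem map_mem_adjoin {ψ : L →+* L} (hψ : ∀ c : K, ∃ c' : K, ψ (algebraMap K L c) = algebraMap K L c')
    {S T : Set L} (hST : ∀ s ∈ S, ψ s ∈ IntermediateField.adjoin K T) {x : L}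
    (hx : x ∈ IntermediateField.adjoin K S) : ψ x ∈ IntermediateField.adjoin K T := by
  induction hx using IntermediateField.adjoin_induction with
  | mem x hx => exact hST x hx
  | algebraMap c =>
    obtain ⟨c', hc'⟩ := hψ c
    rw [hc']
    exact IntermediateField.algebraMap_mem _ c'
  | add x y _ _ hx hy => rw [map_add]; exact add_mem hx hy
  | inv x _ hx => rw [map_inv₀]; exact inv_mem hx
  | mul x y _ _ hx hy => rw [map_mul]; exact mul_mem hx hy

theorem isAlgebraic_map_adjoin {ψ : L →+* L}
    (hψ : ∀ c : K, ∃ c' : K, ψ (algebraMap K L c) = algebraMap K L c')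
    {S T : Set L} (hST : ∀ s ∈ S, ψ s ∈ IntermediateField.adjoin K T) {x : L}
    (hx : IsAlgebraic (IntermediateField.adjoin K S) x) :
    IsAlgebraic (IntermediateField.adjoin K T) (ψ x) := by
  let f : IntermediateField.adjoin K S →+* IntermediateField.adjoin K T :=
    (ψ.comp (algebraMap (IntermediateField.adjoin K S) L)).codRestrict
      (IntermediateField.adjoin K T) fun y => map_mem_adjoin hψ hST y.2
  exact hx.ringHom_of_comp_eq f ψ f.injective (RingHom.ext fun _ => rfl)

theorem isAlgebraic_adjoin_mono {S T : Set L} (hST : S ⊆ T) {x : L}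
    (hx : IsAlgebraic (IntermediateField.adjoin K S) x) :
    IsAlgebraic (IntermediateField.adjoin K T) x := by
  have h := isAlgebraic_map_adjoin (ψ := RingHom.id L) (fun c => ⟨c, RingHom.id_apply _⟩)
    (fun s hs => (RingHom.id_apply s).symm ▸ IntermediateField.subset_adjoin K T (hST hs)) hx
  rwa [RingHom.id_apply] at h

theorem mem_algebraicClosure_of_mem_adjoin {S T : Set L}
    (hST : ∀ s ∈ S, IsAlgebraic (IntermediateField.adjoin K T) s) {x : L}
    (hx : x ∈ IntermediateField.adjoin K S) :
    x ∈ algebraicClosure (IntermediateField.adjoin K T) L := by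
  have hle : IntermediateField.adjoin K S ≤
      (algebraicClosure (IntermediateField.adjoin K T) L).restrictScalars K :=
    IntermediateField.adjoin_le_iff.2 fun s hs => mem_algebraicClosure_iff.2 (hST s hs)
  exact hle hx

theorem isAlgebraic_adjoin_trans {S T : Set L}
    (hST : ∀ s ∈ S, IsAlgebraic (IntermediateField.adjoin K T) s) {x : L}
    (hx : IsAlgebraic (IntermediateField.adjoin K S) x) :
    IsAlgebraic (IntermediateField.adjoin K T) x := by
  set C := algebraicClosure (IntermediateField.adjoin K T) L
  let f : IntermediateField.adjoin K S →+* C :=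
    (algebraMap (IntermediateField.adjoin K S) L).codRestrict C fun y =>
      mem_algebraicClosure_of_mem_adjoin hST y.2
  have hxC : IsAlgebraic C x :=
    hx.ringHom_of_comp_eq f (RingHom.id L) f.injective (RingHom.ext fun _ => rfl)
  exact hxC.restrictScalars (IntermediateField.adjoin K T)

theorem isTranscendenceBasis_of_isAlgebraic_adjoin {E : IntermediateField K L} {ι : Type*}
    {y : ι → E} (hy : AlgebraicIndependent K fun i => (y i : L))
    (halg : ∀ e : E, IsAlgebraic (IntermediateField.adjoin K (Set.range fun i => (y i : L))) (e : L)) :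
    IsTranscendenceBasis K y := by
  refine ⟨AlgebraicIndependent.of_comp E.val hy, fun s hs hle => ?_⟩
  by_contra hne
  obtain ⟨e, hes, hey⟩ := Set.exists_of_ssubset (hle.ssubset_of_ne hne)
  have hsL : AlgebraicIndependent K fun a : s => ((a : E) : L) :=
    AlgebraicIndependent.map' (f := E.val) hs E.val.injective
  -- An element of a larger independent set outside the range of `y` would be transcendental over
  -- the field generated by `y`.
  have htr := hsL.transcendental_adjoin (s := {a : s | (a : E) ∈ Set.range y}) (i := ⟨e, hes⟩) hey
  refine htr ?_
  have himage : (fun a : s => ((a : E) : L)) '' {a : s | (a : E) ∈ Set.range y} =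
      Set.range fun i => (y i : L) := by
    ext z
    constructor
    · rintro ⟨a, ⟨i, hi⟩, rfl⟩
      exact ⟨i, by simp only [hi]⟩
    · rintro ⟨i, rfl⟩
      exact ⟨⟨y i, hle ⟨i, rfl⟩⟩, ⟨i, rfl⟩, rfl⟩
  rw [himage]
  exact IntermediateField.isAlgebraic_adjoin_iff.1 (halg e)

/-! ### Independence along a linear order -/

variable {ι O : Type*} [LinearOrder O]

variable (K) in
/-- `x i` is algebraic over the field generated by the `x j` with smaller key. -/
def IsDependent (κ : ι → O) (x : ι → L) (i : ι) : Prop :=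
  IsAlgebraic (IntermediateField.adjoin K (x '' {j | κ j < κ i})) (x i)

/-- Elements are added in increasing order of key. A dependence of the newest on the others would
involve only strictly smaller keys, by injectivity of `κ`. -/
theorem algebraicIndepOn_finset_not_isDependent {κ : ι → O} (hκ : Function.Injective κ) (x : ι → L)
    (s : Finset ι) (hs : ∀ i ∈ s, ¬ IsDependent K κ x i) : AlgebraicIndepOn K x (s : Set ι) := by
  classical
  induction s using Finset.induction_on_max_value κ with
  | empty =>
    have : IsEmpty ((∅ : Finset ι) : Set ι) := by simp
    exact algebraicIndependent_empty_type_iff.2 (algebraMap K L).injective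
  | insert a s ha hmax ih =>
    rw [Finset.coe_insert]
    refine (ih fun i hi => hs i (Finset.mem_insert_of_mem hi)).insert fun halg => ?_
    refine hs a (Finset.mem_insert_self a s)
      (isAlgebraic_adjoin_mono (Set.image_mono fun j hj => ?_)
        (IntermediateField.isAlgebraic_adjoin_iff.2 halg))
    exact lt_of_le_of_ne (hmax j hj) fun h => ha (hκ h ▸ hj)

/-- The elements which do not depend on the previous ones are algebraically independent. -/
theorem algebraicIndepOn_not_isDependent {κ : ι → O} (hκ : Function.Injective κ) (x : ι → L) :
    AlgebraicIndepOn K x {i | ¬ IsDependent K κ x i} := by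
  classical
  refine algebraicIndependent_of_finite_type fun t ht => ?_
  have h := algebraicIndepOn_finset_not_isDependent (K := K) hκ x (ht.toFinset.image Subtype.val)
    (by
      intro i hi
      obtain ⟨j, -, rfl⟩ := Finset.mem_image.1 hi
      exact j.2)
  exact h.comp (fun a : t => ⟨a.1.1, Finset.mem_image_of_mem _ (ht.mem_toFinset.2 a.2)⟩) fun a b hab => by
    simpa [Subtype.ext_iff] using hab

/-- Induction on the largest key in an initial segment: a dependent element is algebraic over
smaller ones, which are algebraic over the independent ones by induction. -/
theorem isAlgebraic_adjoin_not_isDependent {κ : ι → O} (x : ι → L) (s : Finset ι)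
    (hs : ∀ i ∈ s, ∀ j, κ j < κ i → j ∈ s) (i : ι) (hi : i ∈ s) :
    IsAlgebraic (IntermediateField.adjoin K (x '' {j | j ∈ s ∧ ¬ IsDependent K κ x j})) (x i) := by
  classical
  induction s using Finset.induction_on_max_value κ generalizing i with
  | empty => simp at hi
  | insert a s ha hmax ih =>
    have hlow : ∀ i ∈ s, ∀ j, κ j < κ i → j ∈ s := by
      intro b hb j hj
      refine Finset.mem_of_mem_insert_of_ne (hs b (Finset.mem_insert_of_mem hb) j hj) fun h => ?_
      exact absurd (hmax b hb) (not_le.2 (h ▸ hj))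
    have hsub : {j | j ∈ s ∧ ¬ IsDependent K κ x j} ⊆
        {j | j ∈ insert a s ∧ ¬ IsDependent K κ x j} := fun j hj =>
      ⟨Finset.mem_insert_of_mem hj.1, hj.2⟩
    rcases Finset.mem_insert.1 hi with rfl | hi
    · by_cases hdep : IsDependent K κ x i
      · refine isAlgebraic_adjoin_trans ?_ hdep
        rintro _ ⟨j, hj, rfl⟩
        have hjs : j ∈ s := Finset.mem_of_mem_insert_of_ne
          (hs i (Finset.mem_insert_self _ _) j hj) (by rintro rfl; exact lt_irrefl _ hj)
        exact isAlgebraic_adjoin_mono (Set.image_mono hsub) (ih hlow j hjs)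
      · have hmem : x i ∈ IntermediateField.adjoin K
            (x '' {j | j ∈ insert i s ∧ ¬ IsDependent K κ x j}) :=
          IntermediateField.subset_adjoin K _ ⟨i, ⟨Finset.mem_insert_self _ _, hdep⟩, rfl⟩
        exact isAlgebraic_algebraMap (⟨x i, hmem⟩ : IntermediateField.adjoin K _)
    · exact isAlgebraic_adjoin_mono (Set.image_mono hsub) (ih hlow i hi)

theorem trdeg_adjoin_image {κ : ι → O} (hκ : Function.Injective κ) (x : ι → L) {s : Set ι}
    (hfin : s.Finite) (hs : ∀ i ∈ s, ∀ j, κ j < κ i → j ∈ s) :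
    Algebra.trdeg K (IntermediateField.adjoin K (x '' s)) =
      (Nat.card {i // ¬ IsDependent K κ x i ∧ i ∈ s} : Cardinal) := by
  set y : {i // ¬ IsDependent K κ x i ∧ i ∈ s} → IntermediateField.adjoin K (x '' s) :=
    fun i => ⟨x i, IntermediateField.subset_adjoin K _ ⟨i, i.2.2, rfl⟩⟩ with hy
  have hbasis : IsTranscendenceBasis K y := by
    refine isTranscendenceBasis_of_isAlgebraic_adjoin ?_ fun e => ?_
    · exact (algebraicIndepOn_not_isDependent (K := K) hκ x).comp
        (fun i : {i // ¬ IsDependent K κ x i ∧ i ∈ s} => ⟨i.1, i.2.1⟩)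
        fun a b hab => by simpa [Subtype.ext_iff] using hab
    · refine mem_algebraicClosure_iff.1 (mem_algebraicClosure_of_mem_adjoin ?_ e.2)
      rintro _ ⟨i, hi, rfl⟩
      refine isAlgebraic_adjoin_mono ?_ (isAlgebraic_adjoin_not_isDependent x hfin.toFinset
        (by simpa using hs) i (by simpa using hi))
      rintro _ ⟨j, ⟨hj, hj'⟩, rfl⟩
      exact ⟨⟨j, hj', by simpa using hj⟩, rfl⟩
  have : Finite {i // ¬ IsDependent K κ x i ∧ i ∈ s} :=
    (hfin.subset fun i hi => hi.2 : {i | ¬ IsDependent K κ x i ∧ i ∈ s}.Finite).to_subtype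
  have h := hbasis.lift_cardinalMk_eq_trdeg
  rw [← Nat.cast_card, Cardinal.lift_natCast] at h
  rw [← Cardinal.lift_inj, ← h, Cardinal.lift_natCast]

end Algebraic

/-! ### Transforms -/

theorem prod_ofFn_pow_add {M : Type*} [Monoid M] {m : ℕ} {a : Fin m → M}
    (ha : ∀ i j, Commute (a i) (a j)) (k l : Fin m → ℕ) :
    (List.ofFn fun i => a i ^ (k i + l i)).prod =
      (List.ofFn fun i => a i ^ k i).prod * (List.ofFn fun i => a i ^ l i).prod := by
  induction m with
  | zero => simp
  | succ m ih =>
    simp only [List.ofFn_succ, List.prod_cons]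
    rw [ih fun i j => ha i.succ j.succ, pow_add]
    have hc : Commute (a 0 ^ l 0) (List.ofFn fun i : Fin m => a i.succ ^ k i.succ).prod := by
      refine Commute.list_prod_right _ _ fun b hb => ?_
      obtain ⟨i, rfl⟩ := (List.mem_ofFn' _ _).1 hb
      exact (ha 0 i.succ).pow_pow _ _
    rw [mul_assoc, mul_assoc, ← mul_assoc (a 0 ^ l 0), hc.eq, mul_assoc]

section Transform

variable {K L : Type*} [Field K] [Field L] [Algebra K L] {m : ℕ}
  {σK : Translations m K} {σL : Translations m L}

theorem Translations.transform_add (σ : Translations m L) (k l : Fin m → ℕ) (x : L) :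
    σ.transform (k + l) x = σ.transform k (σ.transform l x) := by
  have h := prod_ofFn_pow_add (M := L →+* L) (a := σ.trans) (fun i j => σ.comm i j) k l
  exact congrArg (fun f : L →+* L => f x) h

theorem IsDifferenceExtension.transform_algebraMap (hext : IsDifferenceExtension σK σL)
    (k : Fin m → ℕ) (c : K) :
    ∃ c' : K, σL.transform k (algebraMap K L c) = algebraMap K L c' := by
  have hpow : ∀ i n (c : K), ∃ c' : K, (σL.trans i ^ n) (algebraMap K L c) = algebraMap K L c' := by
    intro i n
    induction n with
    | zero => exact fun c => ⟨c, by simp⟩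
    | succ n ih =>
      intro c
      rw [pow_succ, RingHom.mul_def, RingHom.comp_apply, hext]
      exact ih _
  have hlist : ∀ l : List (L →+* L),
      (∀ f ∈ l, ∀ c : K, ∃ c' : K, f (algebraMap K L c) = algebraMap K L c') →
      ∀ c : K, ∃ c' : K, l.prod (algebraMap K L c) = algebraMap K L c' := by
    intro l
    induction l with
    | nil => exact fun _ c => ⟨c, by simp⟩
    | cons f l ih =>
      intro hl c
      obtain ⟨c', hc'⟩ := ih (fun g hg => hl g (List.mem_cons_of_mem f hg)) c
      rw [List.prod_cons, RingHom.mul_def, RingHom.comp_apply, hc']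
      exact hl f List.mem_cons_self c'
  refine hlist _ (fun f hf => ?_) c
  obtain ⟨i, rfl⟩ := (List.mem_ofFn' _ _).1 hf
  exact hpow i (k i)

end Transform

/-! ### Leading exponents -/

theorem weightedOrder_add {m : ℕ} (w k l : Fin m → ℕ) :
    weightedOrder w (k + l) = weightedOrder w k + weightedOrder w l := by
  simp [weightedOrder, mul_add, Finset.sum_add_distrib]

/-- A key for the transforms of a family with offsets `d`, refining the weighted order. -/
def transformKey {m : ℕ} {J : Type*} (w : Fin m → ℕ) (d e : J → ℕ) (p : (Fin m → ℕ) × J) :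
    ℕ ×ₗ (Lex (Fin m → ℕ) ×ₗ ℕ) :=
  toLex (weightedOrder w p.1 + d p.2, toLex (toLex p.1, e p.2))

section Key

variable {m : ℕ} {J : Type*} {w : Fin m → ℕ} {d e : J → ℕ}

theorem transformKey_injective (he : Function.Injective e) :
    Function.Injective (transformKey w d e) := by
  rintro ⟨k, j⟩ ⟨k', j'⟩ h
  have h2 := congrArg (fun a => (ofLex (ofLex a).2)) h
  simp only [transformKey, ofLex_toLex, Prod.mk.injEq, EmbeddingLike.apply_eq_iff_eq] at h2
  rw [h2.1, he h2.2]

/-- Translation adds the same constant to both weighted orders, preserves the lexicographic order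
and leaves the tie-breaker alone. This makes the sets of leading exponents upper sets. -/
theorem add_lt_add_of_transformKey_lt {p q : (Fin m → ℕ) × J} (l : Fin m → ℕ)
    (h : transformKey w d e p < transformKey w d e q) :
    transformKey w d e (l + p.1, p.2) < transformKey w d e (l + q.1, q.2) := by
  simp only [transformKey, Prod.Lex.toLex_lt_toLex, weightedOrder_add] at h ⊢
  rcases h with h | ⟨h, h' | ⟨h', h''⟩⟩
  · exact Or.inl (by omega)
  · refine Or.inr ⟨by omega, Or.inl ?_⟩
    exact add_lt_add_right h' (toLex l)
  · refine Or.inr ⟨by omega, Or.inr ⟨?_, h''⟩⟩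
    rw [toLex.injective h']

/-- Truncations by order are thus initial segments for the key. -/
theorem le_of_transformKey_lt {p q : (Fin m → ℕ) × J}
    (h : transformKey w d e p < transformKey w d e q) :
    weightedOrder w p.1 + d p.2 ≤ weightedOrder w q.1 + d q.2 := by
  simp only [transformKey, Prod.Lex.toLex_lt_toLex] at h
  omega

end Key

/-- The field generated by the transforms of a family `ξ`, with offsets `d`, of order at most `r`. -/
def offsetTruncation (K : Type*) {L : Type*} [Field K] [Field L] [Algebra K L] {m : ℕ}
    (σL : Translations m L) (w : Fin m → ℕ) {J : Type*} (ξ : J → L) (d : J → ℕ) (r : ℕ) : IntermediateField K L :=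
  IntermediateField.adjoin K ((fun p : (Fin m → ℕ) × J => σL.transform p.1 (ξ p.2)) ''
    {p | weightedOrder w p.1 + d p.2 ≤ r})

/-- The upper sets `E` count the transcendence degrees of the truncations of the family `ξ`. -/
def CountsTrdeg (K : Type*) {L : Type*} [Field K] [Field L] [Algebra K L] {m : ℕ}
    (σL : Translations m L) (w : Fin m → ℕ) {J : Type*} [Fintype J] (ξ : J → L) (d : J → ℕ)
    (E : J → Set (Fin m → ℕ)) : Prop :=
  ∀ r : ℕ, ∃ D : ℕ, Algebra.trdeg K (offsetTruncation K σL w ξ d r) = (D : Cardinal) ∧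
    ∑ j, countCompl w (E j) ((r : ℤ) - d j) = (D : ℚ)

section Leading

variable {K L : Type*} [Field K] [Field L] [Algebra K L] {m : ℕ}
  {σK : Translations m K} {σL : Translations m L}

/-- The transforms of a finite family `ξ`, the order being shifted by offsets `d`: their
transcendence degrees count the complements of upper sets. -/
theorem exists_leading_exponents (hext : IsDifferenceExtension σK σL) {w : Fin m → ℕ}
    (hw : ∀ i, 0 < w i) {J : Type*} [Fintype J] (ξ : J → L) (d : J → ℕ) :
    ∃ E : J → Set (Fin m → ℕ), (∀ j, IsUpperSet (E j)) ∧
      AlgebraicIndepOn K (fun p : (Fin m → ℕ) × J => σL.transform p.1 (ξ p.2))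
        {p | p.1 ∉ E p.2} ∧
      CountsTrdeg K σL w ξ d E ∧
      ∀ r : ℕ, AlgebraicIndepOn K (fun p : (Fin m → ℕ) × J => σL.transform p.1 (ξ p.2))
          {p | weightedOrder w p.1 + d p.2 ≤ r} →
        ∀ k j, weightedOrder w k + d j ≤ r → k ∉ E j := by
  obtain ⟨e, he⟩ := exists_injective_nat J
  set x : (Fin m → ℕ) × J → L := fun p => σL.transform p.1 (ξ p.2) with hx
  set κ := transformKey w d e with hκ
  have hκi : Function.Injective κ := transformKey_injective he
  refine ⟨fun j => {k | IsDependent K κ x (k, j)}, fun j k k' hkk' hk => ?_,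
    algebraicIndepOn_not_isDependent hκi x, fun r => ?_, fun r hind k j hkj hdep => ?_⟩
  · have hk' : k' = (k' - k) + k := (tsub_add_cancel_of_le hkk').symm
    have hadd : ∀ p : (Fin m → ℕ) × J,
        σL.transform (k' - k) (x p) = x ((k' - k) + p.1, p.2) := fun p =>
      (σL.transform_add _ _ _).symm
    -- The transform by `k' - k` carries the dependence at `(k, j)` to one at `(k', j)`, still over
    -- smaller keys.
    have h := isAlgebraic_map_adjoin (hext.transform_algebraMap (k' - k))
      (T := x '' {p | κ p < κ (k', j)}) (fun s hs => by
        obtain ⟨p, hp, rfl⟩ := hs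
        refine IntermediateField.subset_adjoin K _ ⟨((k' - k) + p.1, p.2), ?_, (hadd p).symm⟩
        have := add_lt_add_of_transformKey_lt (k' - k) hp
        rwa [← hk'] at this) hk
    rw [hadd, ← hk'] at h
    exact h
  · have hfin : {p : (Fin m → ℕ) × J | weightedOrder w p.1 + d p.2 ≤ r}.Finite := by
      refine ((finite_weightedOrder_le hw (r : ℤ)).prod (Set.finite_univ (α := J))).subset ?_
      intro p hp
      refine ⟨?_, Set.mem_univ _⟩
      have hp' : weightedOrder w p.1 + d p.2 ≤ r := hp
      change (weightedOrder w p.1 : ℤ) ≤ r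
      omega
    refine ⟨_, trdeg_adjoin_image hκi x hfin fun i hi j hj =>
      (le_of_transformKey_lt hj).trans hi, ?_⟩
    have hcount : ∀ j, countCompl w {k | IsDependent K κ x (k, j)} ((r : ℤ) - d j) =
        (Nat.card {k // ¬ IsDependent K κ x (k, j) ∧ weightedOrder w k + d j ≤ r} : ℚ) := by
      intro j
      rw [countCompl, ← Nat.card_coe_set_eq]
      refine congrArg Nat.cast (Nat.card_congr (Equiv.subtypeEquivRight fun k => ?_))
      refine and_congr Iff.rfl ?_
      omega
    have hfinj : ∀ j, Finite {k // ¬ IsDependent K κ x (k, j) ∧ weightedOrder w k + d j ≤ r} := by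
      intro j
      have := hfin.to_subtype
      refine Finite.of_injective
        (β := {p : (Fin m → ℕ) × J | weightedOrder w p.1 + d p.2 ≤ r})
        (fun k => ⟨(k.1, j), k.2.2⟩) fun a b hab => ?_
      simpa [Subtype.ext_iff] using hab
    rw [Finset.sum_congr rfl fun j _ => hcount j, ← Nat.cast_sum, ← Nat.card_sigma]
    refine congrArg Nat.cast (Nat.card_congr
      { toFun := fun a => ⟨(a.2.1, a.1), a.2.2⟩
        invFun := fun p => ⟨p.1.2, p.1.1, p.2⟩
        left_inv := fun _ => rfl
        right_inv := fun _ => rfl })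
  · set s : Set ((Fin m → ℕ) × J) := {p | κ p < κ (k, j)} with hs
    have hsub : insert (k, j) s ⊆ {p | weightedOrder w p.1 + d p.2 ≤ r} := by
      intro p hp
      rcases hp with rfl | hp
      · exact hkj
      · exact (le_of_transformKey_lt hp).trans hkj
    have h := (AlgebraicIndepOn.insert_iff (show (k, j) ∉ s from lt_irrefl (κ (k, j)))).1 (hind.mono hsub)
    exact h.2 (IntermediateField.isAlgebraic_adjoin_iff.1 hdep)

end Leading

/-! ### Sums of complement counts -/

theorem AgreesWithQuasi.exists_sum {d : ℕ} {ι : Type*} (s : Finset ι) {e : ι → ℚ} {f : ι → ℤ → ℚ}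
    (h : ∀ i ∈ s, ∃ N, AgreesWithQuasi d (e i) N (f i)) :
    ∃ N, AgreesWithQuasi d (∑ i ∈ s, e i) N (fun t => ∑ i ∈ s, f i t) := by
  classical
  induction s using Finset.induction_on with
  | empty => exact ⟨0, by simpa using AgreesWithQuasi.zero d 0⟩
  | insert a s ha ih =>
    obtain ⟨N, hN⟩ := h a (Finset.mem_insert_self a s)
    obtain ⟨M, hM⟩ := ih fun i hi => h i (Finset.mem_insert_of_mem hi)
    simp only [Finset.sum_insert ha]
    exact ⟨max N M, (hN.mono (le_max_left _ _)).add (hM.mono (le_max_right _ _))⟩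

/-- The coefficient of order `m` of the Ehrhart quasi-polynomial of the conic polytope. -/
noncomputable def conicCoeff {m : ℕ} (w : Fin m → ℕ) : ℚ := 1 / ((m ! : ℚ) * ∏ i, (w i : ℚ))

theorem conicCoeff_pos {m : ℕ} {w : Fin m → ℕ} (hw : ∀ i, 0 < w i) : 0 < conicCoeff w := by
  have : 0 < ∏ i, (w i : ℚ) := Finset.prod_pos fun i _ => by exact_mod_cast hw i
  rw [conicCoeff]
  positivity

open Classical in
theorem exists_agreesWithQuasi_countCompl {m : ℕ} {w : Fin m → ℕ} (hw : ∀ i, 0 < w i)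
    {E : Set (Fin m → ℕ)} (hE : IsUpperSet E) :
    ∃ N, AgreesWithQuasi m (if E = ∅ then conicCoeff w else 0) N (countCompl w E) := by
  split_ifs with h
  · rw [h]
    exact ⟨0, agreesWithQuasi_countCompl_empty hw⟩
  · exact agreesWithQuasi_countCompl_of_nonempty hw hE (Set.nonempty_iff_ne_empty.2 h)

/-- `Φ` and `f` vanish, or `Φ` represents `f` and has a constant positive leading coefficient. -/
def IsLeading (Φ : QuasiPolynomial) (f : ℤ → ℚ) : Prop :=
  (Φ = 0 ∧ f = fun _ => 0) ∨ ∃ d : ℕ, ∃ e > 0, (∃ N, AgreesWithQuasi d e N f) ∧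
    Φ.degree = d ∧ Φ.leadingCoeff = algebraMap ℚ periodicNumber e

theorem isLeading_of_hasPosLeading {Φ : QuasiPolynomial} {f : ℤ → ℚ} (hf : HasPosLeading f)
    (hΦ : ∀ᶠ r : ℕ in atTop, evalAt Φ r = f r) : IsLeading Φ f := by
  rcases hf with rfl | ⟨d, e, he, N, hN⟩
  · refine Or.inl ⟨QuasiPolynomial.ext_of_eventually (hΦ.mono fun r hr => ?_), rfl⟩
    rw [hr]
    exact (Polynomial.eval₂_zero _ _).symm
  · obtain ⟨Ψ, hdeg, hcoeff, heval⟩ := hN.exists_quasiPolynomial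
    have hΦΨ : Φ = Ψ := by
      refine QuasiPolynomial.ext_of_eventually ?_
      filter_upwards [hΦ, tendsto_natCast_atTop_atTop.eventually_ge_atTop N] with r hr hr'
      rw [hr, heval _ hr']
    have hne : Ψ.coeff d ≠ 0 := by
      rw [hcoeff]
      exact (map_ne_zero_iff _ (algebraMap ℚ periodicNumber).injective).2 he.ne'
    have hdeg' : Ψ.degree = d := Polynomial.degree_eq_of_le_of_coeff_ne_zero hdeg hne
    refine Or.inr ⟨d, e, he, ⟨N, hN⟩, hΦΨ ▸ hdeg', ?_⟩
    rw [hΦΨ, Polynomial.leadingCoeff, Polynomial.natDegree_eq_of_degree_eq_some hdeg', hcoeff]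

theorem AgreesWithQuasi.le_of_eventually_le_shift {d d' : ℕ} {e e' : ℚ} {N N' : ℤ} {f f' : ℤ → ℚ}
    (h : AgreesWithQuasi d e N f) (h' : AgreesWithQuasi d' e' N' f') (he : 0 < e) {c : ℕ}
    (hle : ∀ r : ℕ, f r ≤ f' (r + c)) : d ≤ d' ∧ (d = d' → e ≤ e') := by
  have hs := h'.shift (-c)
  have hle' : ∀ᶠ r : ℕ in atTop, f r ≤ f' (r - -(c : ℤ)) := Eventually.of_forall fun r => by
    simpa using hle r
  refine ⟨not_lt.1 fun hlt => ?_, ?_⟩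
  · exact absurd ((h.mono (le_max_left _ _)).coeff_le_of_eventually_le
      ((hs.lift hlt).mono (le_max_right _ _)) hle') (not_le.2 he)
  · rintro rfl
    exact (h.mono (le_max_left _ _)).coeff_le_of_eventually_le (hs.mono (le_max_right _ _)) hle'

/-- A bounded shift of the argument changes neither degree nor leading coefficient, so mutual
domination up to shifts forces both to coincide. -/
theorem IsLeading.degree_eq_and_leadingCoeff_eq {Φ Ψ : QuasiPolynomial} {f g : ℤ → ℚ}
    (hΦ : IsLeading Φ f) (hΨ : IsLeading Ψ g) {c c' : ℕ} (hfg : ∀ r : ℕ, f r ≤ g (r + c))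
    (hgf : ∀ r : ℕ, g r ≤ f (r + c')) :
    Ψ.degree = Φ.degree ∧ Ψ.leadingCoeff = Φ.leadingCoeff := by
  rcases hΦ with ⟨rfl, rfl⟩ | ⟨d, e, he, ⟨N, hN⟩, hdeg, hlc⟩ <;>
  rcases hΨ with ⟨rfl, rfl⟩ | ⟨d', e', he', ⟨N', hN'⟩, hdeg', hlc'⟩
  · exact ⟨rfl, rfl⟩
  · exact absurd ((hN'.le_of_eventually_le_shift (AgreesWithQuasi.zero d' 0) he' (c := c') hgf).2 rfl)
      (not_le.2 he')
  · exact absurd ((hN.le_of_eventually_le_shift (AgreesWithQuasi.zero d 0) he (c := c) hfg).2 rfl)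
      (not_le.2 he)
  · have h1 := hN.le_of_eventually_le_shift hN' he hfg
    have h2 := hN'.le_of_eventually_le_shift hN he' hgf
    obtain rfl : d = d' := le_antisymm h1.1 h2.1
    obtain rfl : e = e' := le_antisymm (h1.2 rfl) (h2.2 rfl)
    exact ⟨hdeg'.trans hdeg.symm, hlc'.trans hlc.symm⟩

theorem isAlternatingEhrhartSum_of_isAltSum {m : ℕ} {w : Fin m → ℕ} (hw : ∀ i, 0 < w i)
    {f : ℤ → ℚ} (hf : IsAltSum (countCompl w ∅) f) {Φ : QuasiPolynomial}
    (hΦ : ∀ᶠ r : ℕ in atTop, evalAt Φ r = f r) : IsAlternatingEhrhartSum w Φ := by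
  obtain ⟨lam, -, -, hlam⟩ := (agreesWithQuasi_countCompl_empty hw).exists_quasiPolynomial
  refine ⟨lam, fun r hr => ?_, ?_⟩
  · rw [hlam _ (Int.natCast_nonneg r), latticeCount_conicPolytope w hr]
  obtain ⟨N, ε, c, hf⟩ := hf
  refine ⟨N, ε, c, fun t => ?_⟩
  -- `lam` matches the count only at nonnegative arguments, so the identity is first known for `r`
  -- beyond all shifts. Both sides being quasi-polynomials of degree below `D`, it extends to every
  -- integer.
  set D := Φ.natDegree + lam.natDegree + 1 with hD
  have h1 : AgreesWithQuasi D 0 t (evalAt Φ) := agreesWithQuasi_evalAt Φ (by omega) t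
  have h2 : ∀ i, AgreesWithQuasi D 0 t
      (fun t => ((ε i : ℤ) : ℚ) * evalAt lam (t - (c i : ℤ))) := by
    intro i
    have h := (((agreesWithQuasi_evalAt lam (d := D) (by omega) (t - c i)).shift (c i)).const_mul
      ((ε i : ℤ) : ℚ))
    rwa [sub_add_cancel, mul_zero] at h
  have h3 := h1.add ((AgreesWithQuasi.sum Finset.univ fun i _ => h2 i).const_mul (-1))
  have h4 := h3.eq_zero_of_eventually (t := t) (by
    have hc : ∀ᶠ r : ℕ in atTop, ∀ i, c i ≤ r := eventually_all.2 fun i => eventually_ge_atTop (c i)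
    filter_upwards [hΦ, hc] with r hr hr'
    have hsum : ∑ i, ((ε i : ℤ) : ℚ) * evalAt lam ((r : ℤ) - (c i : ℤ)) = f r := by
      rw [hf]
      refine Finset.sum_congr rfl fun i _ => ?_
      rw [hlam _ (by have := hr' i; omega)]
    rw [hr, hsum]
    ring) le_rfl
  linarith

open Classical in
/-- The quasi-polynomial of a sum of counts of complements of upper sets. -/
theorem exists_quasiPolynomial_sum_countCompl {m : ℕ} {w : Fin m → ℕ} (hw : ∀ i, 0 < w i)
    {J : Type*} [Fintype J] {E : J → Set (Fin m → ℕ)} (hE : ∀ j, IsUpperSet (E j)) :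
    ∃ Φ : QuasiPolynomial, (∀ᶠ r : ℕ in atTop, evalAt Φ r = ∑ j, countCompl w (E j) r) ∧
      Φ.degree ≤ (m : WithBot ℕ) ∧ IsAlternatingEhrhartSum w Φ ∧
      IsLeading Φ (fun t => ∑ j, countCompl w (E j) t) ∧
      Φ.coeff m = algebraMap ℚ periodicNumber
        ((Fintype.card {j // E j = ∅} : ℚ) / ((m ! : ℚ) * ∏ i, (w i : ℚ))) := by
  obtain ⟨N, hN⟩ := AgreesWithQuasi.exists_sum Finset.univ fun j _ =>
    exists_agreesWithQuasi_countCompl hw (hE j)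
  obtain ⟨Φ, hdeg, hcoeff, heval⟩ := hN.exists_quasiPolynomial
  have hΦ : ∀ᶠ r : ℕ in atTop, evalAt Φ r = ∑ j, countCompl w (E j) r := by
    filter_upwards [tendsto_natCast_atTop_atTop.eventually_ge_atTop N] with r hr
    exact heval _ hr
  refine ⟨Φ, hΦ, hdeg, isAlternatingEhrhartSum_of_isAltSum hw
    (IsAltSum.sum Finset.univ fun j _ => isAltSum_countCompl hw (hE j)) hΦ,
    isLeading_of_hasPosLeading (HasPosLeading.sum Finset.univ fun j _ =>
      hasPosLeading_countCompl hw (hE j)) hΦ, ?_⟩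
  rw [hcoeff, Finset.sum_ite, Finset.sum_const, Finset.sum_const_zero, add_zero, nsmul_eq_mul,
    conicCoeff, mul_one_div, Fintype.card_subtype]

/-! ### Truncations -/

section Truncation

variable {K L : Type*} [Field K] [Field L] [Algebra K L] {m : ℕ}
  {σK : Translations m K} {σL : Translations m L} {w : Fin m → ℕ}

theorem truncation_eq {n : ℕ} (η : Fin n → L) (r : ℕ) :
    truncation K σL w η r = offsetTruncation K σL w η (fun _ => 0) r := by
  rw [truncation, offsetTruncation]
  congr 1
  ext x
  constructor
  · rintro ⟨k, hk, i, rfl⟩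
    exact ⟨(k, i), hk, rfl⟩
  · rintro ⟨⟨k, i⟩, hk, rfl⟩
    exact ⟨k, hk, i, rfl⟩

theorem offsetTruncation_mono {J : Type*} (ξ : J → L) (d : J → ℕ) :
    Monotone (offsetTruncation K σL w ξ d) := fun _ _ hrs =>
  IntermediateField.adjoin.mono _ _ _ (Set.image_mono fun _ hp => le_trans hp hrs)

theorem transform_mem_offsetTruncation (hext : IsDifferenceExtension σK σL) {J : Type*} {ξ : J → L}
    {d : J → ℕ} {r : ℕ} {x : L} (hx : x ∈ offsetTruncation K σL w ξ d r) (k : Fin m → ℕ) :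
    σL.transform k x ∈ offsetTruncation K σL w ξ d (weightedOrder w k + r) := by
  refine map_mem_adjoin (hext.transform_algebraMap k) ?_ hx
  rintro _ ⟨p, hp, rfl⟩
  refine IntermediateField.subset_adjoin K _ ⟨(k + p.1, p.2), ?_, σL.transform_add _ _ _⟩
  have hp' : weightedOrder w p.1 + d p.2 ≤ r := hp
  change weightedOrder w (k + p.1) + d p.2 ≤ _
  rw [weightedOrder_add]
  omega

theorem Generates.exists_mem_offsetTruncation {n : ℕ} {η : Fin n → L} (hη : Generates K σL η)
    (x : L) : ∃ h, x ∈ offsetTruncation K σL w η (fun _ => 0) h := by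
  have hx : x ∈ diffAdjoin K σL (Set.range η) := by
    rw [hη]
    exact IntermediateField.mem_top
  induction hx using IntermediateField.adjoin_induction with
  | mem x hx =>
    obtain ⟨k, _, ⟨i, rfl⟩, rfl⟩ := hx
    exact ⟨weightedOrder w k, IntermediateField.subset_adjoin K _
      ⟨(k, i), le_refl (weightedOrder w k), rfl⟩⟩
  | algebraMap c => exact ⟨0, IntermediateField.algebraMap_mem _ c⟩
  | add x y _ _ hx hy =>
    obtain ⟨h, hx⟩ := hx
    obtain ⟨h', hy⟩ := hy
    exact ⟨max h h', add_mem (offsetTruncation_mono _ _ (le_max_left h h') hx)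
      (offsetTruncation_mono _ _ (le_max_right h h') hy)⟩
  | inv x _ hx =>
    obtain ⟨h, hx⟩ := hx
    exact ⟨h, inv_mem hx⟩
  | mul x y _ _ hx hy =>
    obtain ⟨h, hx⟩ := hx
    obtain ⟨h', hy⟩ := hy
    exact ⟨max h h', mul_mem (offsetTruncation_mono _ _ (le_max_left h h') hx)
      (offsetTruncation_mono _ _ (le_max_right h h') hy)⟩

theorem Generates.exists_offsetTruncation_le (hext : IsDifferenceExtension σK σL) {n : ℕ}
    {η : Fin n → L} (hη : Generates K σL η) {J : Type*} [Fintype J] (ξ : J → L) :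
    ∃ h, ∀ r, offsetTruncation K σL w ξ (fun _ => 0) r ≤
      offsetTruncation K σL w η (fun _ => 0) (r + h) := by
  choose h hh using fun j => hη.exists_mem_offsetTruncation (w := w) (ξ j)
  refine ⟨Finset.univ.sup h, fun r => IntermediateField.adjoin_le_iff.2 ?_⟩
  rintro _ ⟨p, hp, rfl⟩
  refine offsetTruncation_mono _ _ ?_ (transform_mem_offsetTruncation hext (hh p.2) p.1)
  have hp' : weightedOrder w p.1 + 0 ≤ r := hp
  have := Finset.le_sup (f := h) (Finset.mem_univ p.2)
  omega

theorem natCast_trdeg_le {E F : IntermediateField K L} (hEF : E ≤ F) {a b : ℕ}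
    (ha : Algebra.trdeg K E = (a : Cardinal)) (hb : Algebra.trdeg K F = (b : Cardinal)) :
    (a : ℚ) ≤ b := by
  have h := trdeg_le_of_injective (IntermediateField.inclusion hEF)
    (IntermediateField.inclusion_injective hEF)
  rw [ha, hb] at h
  exact_mod_cast h

theorem CountsTrdeg.le {J J' : Type*} [Fintype J] [Fintype J'] {ξ : J → L} {d : J → ℕ}
    {E : J → Set (Fin m → ℕ)} {ξ' : J' → L} {d' : J' → ℕ} {E' : J' → Set (Fin m → ℕ)}
    (h : CountsTrdeg K σL w ξ d E) (h' : CountsTrdeg K σL w ξ' d' E') {r r' : ℕ}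
    (hle : offsetTruncation K σL w ξ d r ≤ offsetTruncation K σL w ξ' d' r') :
    ∑ j, countCompl w (E j) ((r : ℤ) - d j) ≤ ∑ j, countCompl w (E' j) ((r' : ℤ) - d' j) := by
  obtain ⟨D, hD, hD'⟩ := h r
  obtain ⟨D₁, hD₁, hD₁'⟩ := h' r'
  rw [hD', hD₁']
  exact natCast_trdeg_le hle hD hD₁

/-! ### The difference transcendence degree -/

open Classical in
-- Independence leaves `b` without leading exponents, so its truncations have transcendence degree
-- `|J|` times the full count. They lie in truncations of `η` up to a shift, and the coefficients of
-- order `m` are compared.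
theorem card_le_of_algebraicIndependent (hext : IsDifferenceExtension σK σL) (hw : ∀ i, 0 < w i)
    {n : ℕ} {η : Fin n → L} (hη : Generates K σL η) {E : Fin n → Set (Fin m → ℕ)}
    (hE : ∀ j, IsUpperSet (E j)) (hcount : CountsTrdeg K σL w η (fun _ => 0) E)
    {J : Type*} [Fintype J] {b : J → L}
    (hb : AlgebraicIndependent K fun p : (Fin m → ℕ) × J => σL.transform p.1 (b p.2)) :
    Fintype.card J ≤ Fintype.card {j // E j = ∅} := by
  obtain ⟨E', -, -, hcount', hlow⟩ := exists_leading_exponents (K := K) hext hw b (fun _ => 0)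
  have hE' : ∀ j, E' j = ∅ := fun j => Set.eq_empty_of_forall_notMem fun k =>
    hlow (weightedOrder w k) (hb.comp _ Subtype.val_injective) k j le_rfl
  obtain ⟨h, hh⟩ := hη.exists_offsetTruncation_le (w := w) hext b
  obtain ⟨N, hN⟩ := AgreesWithQuasi.exists_sum Finset.univ fun j _ =>
    exists_agreesWithQuasi_countCompl hw (hE j)
  have hN' := AgreesWithQuasi.sum (Finset.univ (α := J)) fun _ _ =>
    agreesWithQuasi_countCompl_empty hw
  have hle := (hN'.mono (le_max_left _ _)).coeff_le_of_eventually_le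
    ((hN.shift (-h)).mono (le_max_right _ _)) (Eventually.of_forall fun r => by
      have := CountsTrdeg.le hcount' hcount (hh r)
      simpa [hE'] using this)
  change ∑ _j : J, conicCoeff w ≤ _ at hle
  rw [Finset.sum_ite, Finset.sum_const, Finset.sum_const, Finset.sum_const_zero, add_zero,
    nsmul_eq_mul, nsmul_eq_mul, ← Fintype.card_subtype, Finset.card_univ] at hle
  exact_mod_cast le_of_mul_le_mul_right hle (conicCoeff_pos hw)

theorem diffAdjoin_eq (B : Set L) : diffAdjoin K σL B = IntermediateField.adjoin K
    (Set.range fun p : (Fin m → ℕ) × B => σL.transform p.1 (p.2 : L)) := by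
  rw [diffAdjoin]
  congr 1
  ext x
  constructor
  · rintro ⟨k, s, hs, rfl⟩
    exact ⟨(k, ⟨s, hs⟩), rfl⟩
  · rintro ⟨p, rfl⟩
    exact ⟨p.1, p.2, p.2.2, rfl⟩

/-- The transforms of `a` and of the elements of `B` are jointly independent if and only if those
of `B` are and those of `a` are independent over the difference field generated by `B`. -/
theorem algebraicIndependent_sumElim_iff (B : Set L) (a : L) :
    AlgebraicIndependent K (Sum.elim (fun k : Fin m → ℕ => σL.transform k a)
        (fun p : (Fin m → ℕ) × B => σL.transform p.1 (p.2 : L))) ↔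
      AlgebraicIndependent K (fun p : (Fin m → ℕ) × B => σL.transform p.1 (p.2 : L)) ∧
        AlgebraicIndependent (diffAdjoin K σL B) (fun k : Fin m → ℕ => σL.transform k a) := by
  rw [AlgebraicIndependent.sumElim_iff, diffAdjoin_eq,
    IntermediateField.algebraicIndependent_adjoin_iff]

open Classical in
theorem isDiffTranscendenceBasis_range (hext : IsDifferenceExtension σK σL) (hw : ∀ i, 0 < w i)
    {n : ℕ} {η : Fin n → L} (hη : Generates K σL η) {E : Fin n → Set (Fin m → ℕ)}
    (hE : ∀ j, IsUpperSet (E j)) (hcount : CountsTrdeg K σL w η (fun _ => 0) E)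
    (hind : AlgebraicIndepOn K (fun p : (Fin m → ℕ) × Fin n => σL.transform p.1 (η p.2))
      {p | p.1 ∉ E p.2}) :
    IsDiffTranscendenceBasis K σL (Set.range fun j : {j // E j = ∅} => η j) := by
  set B := Set.range fun j : {j // E j = ∅} => η j with hB
  choose g hg using fun b : B => b.2
  have hBind : AlgebraicIndependent K
      fun p : (Fin m → ℕ) × B => σL.transform p.1 (p.2 : L) := by
    have h := hind.comp (fun p : (Fin m → ℕ) × B => ⟨(p.1, (g p.2).1), by
      change p.1 ∉ E (g p.2).1
      rw [(g p.2).2]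
      exact Set.notMem_empty _⟩) fun p q hpq => by
        simp only [Subtype.mk.injEq, Prod.mk.injEq] at hpq
        refine Prod.ext hpq.1 (Subtype.ext ?_)
        rw [← hg p.2, ← hg q.2]
        exact congrArg η hpq.2
    convert h using 2 with p
    exact congrArg _ (hg p.2).symm
  refine ⟨hBind, fun a ha => ?_⟩
  -- If the transforms of `a` were independent over `K⟨B⟩`, adjoining `a` would give an independent
  -- family with one member more than the bound allows.
  have hsum := (algebraicIndependent_sumElim_iff B a).2 ⟨hBind, ha⟩
  have hinj : Function.Injective fun j : {j // E j = ∅} => (⟨η j, j, rfl⟩ : B) := by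
    intro i j hij
    have h := hind.injective (a₁ := ⟨((0 : Fin m → ℕ), i.1), by simp [i.2]⟩)
      (a₂ := ⟨((0 : Fin m → ℕ), j.1), by simp [j.2]⟩) (by
        simpa [Subtype.ext_iff] using congrArg (σL.transform 0) (congrArg Subtype.val hij))
    simpa [Subtype.ext_iff] using h
  have hopt := hsum.comp (fun p : (Fin m → ℕ) × Option {j // E j = ∅} =>
      p.2.elim (Sum.inl p.1) fun j => Sum.inr (p.1, (⟨η j, j, rfl⟩ : B))) (by
    rintro ⟨k, _ | i⟩ ⟨l, _ | j⟩ h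
    · simpa using h
    · simp at h
    · simp at h
    · simp only [Option.elim_some, Sum.inr.injEq, Prod.mk.injEq] at h
      rw [h.1, hinj h.2])
  have hcard := card_le_of_algebraicIndependent hext hw hη hE hcount
    (b := fun o : Option {j // E j = ∅} => o.elim a fun j => η j) (by
      convert hopt using 2 with p
      rcases p with ⟨k, _ | j⟩ <;> rfl)
  rw [Fintype.card_option] at hcard
  omega

open Classical in
theorem IsDiffTranscendenceBasis.finite_and_ncard_le (hext : IsDifferenceExtension σK σL)
    (hw : ∀ i, 0 < w i) {n : ℕ} {η : Fin n → L} (hη : Generates K σL η)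
    {E : Fin n → Set (Fin m → ℕ)} (hE : ∀ j, IsUpperSet (E j))
    (hcount : CountsTrdeg K σL w η (fun _ => 0) E) {B : Set L}
    (hB : IsDiffTranscendenceBasis K σL B) :
    B.Finite ∧ B.ncard ≤ Fintype.card {j // E j = ∅} := by
  have hsub : ∀ s : Finset L, (s : Set L) ⊆ B → s.card ≤ Fintype.card {j // E j = ∅} := by
    intro s hs
    have h := card_le_of_algebraicIndependent hext hw hη hE hcount (b := fun x : s => (x : L))
      (hB.indep.comp (fun p : (Fin m → ℕ) × s => (p.1, ⟨p.2, hs p.2.2⟩)) fun p q hpq => by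
        simp only [Prod.mk.injEq, Subtype.mk.injEq] at hpq
        exact Prod.ext hpq.1 (Subtype.ext hpq.2))
    simpa using h
  have hfin : B.Finite := by
    by_contra hinf
    obtain ⟨s, hs, hcard⟩ := Set.Infinite.exists_subset_card_eq hinf
      (Fintype.card {j // E j = ∅} + 1)
    have := hsub s hs
    omega
  refine ⟨hfin, ?_⟩
  rw [Set.ncard_eq_toFinset_card B hfin]
  exact hsub _ (by simp)

open Classical in
-- In the joint family of `B` and `η`, every `ηᵢ` must have a leading exponent, so only members of
-- `B` contribute to the coefficient of order `m`. The joint truncations contain those of `η` up to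
-- a shift.
theorem IsDiffTranscendenceBasis.le_ncard (hext : IsDifferenceExtension σK σL)
    (hw : ∀ i, 0 < w i) {n : ℕ} {η : Fin n → L}
    {E : Fin n → Set (Fin m → ℕ)} (hE : ∀ j, IsUpperSet (E j))
    (hcount : CountsTrdeg K σL w η (fun _ => 0) E) {B : Set L}
    (hB : IsDiffTranscendenceBasis K σL B) (hfin : B.Finite) :
    Fintype.card {j // E j = ∅} ≤ B.ncard := by
  have := hfin.fintype
  have hdep : ∀ i, ∃ t : Set ((Fin m → ℕ) ⊕ ((Fin m → ℕ) × B)), t.Finite ∧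
      ¬ AlgebraicIndepOn K (Sum.elim (fun k : Fin m → ℕ => σL.transform k (η i))
        (fun p : (Fin m → ℕ) × B => σL.transform p.1 (p.2 : L))) t := by
    intro i
    by_contra! h
    exact hB.algebraic (η i) ((algebraicIndependent_sumElim_iff B (η i)).1
      (algebraicIndependent_of_finite_type h)).2
  choose t htfin ht using hdep
  -- `H` bounds the orders of the transforms of `B` in the chosen finite dependences of all the
  -- `ηᵢ`. The offset `H + 1` on `η` places these transforms of `B` before every transform of `η`,
  -- so the truncation at `H` involves `B` alone.
  set H : ℕ := Finset.univ.sup fun i => (htfin i).toFinset.sup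
    (Sum.elim (fun _ => 0) fun p : (Fin m → ℕ) × B => weightedOrder w p.1) with hH
  have hHle : ∀ i p, Sum.inr p ∈ t i → weightedOrder w p.1 ≤ H := by
    intro i p hp
    have h1 := Finset.le_sup (f := Sum.elim (fun _ => 0) fun p : (Fin m → ℕ) × B =>
      weightedOrder w p.1) ((htfin i).mem_toFinset.2 hp)
    exact h1.trans (Finset.le_sup (f := fun i => (htfin i).toFinset.sup
      (Sum.elim (fun _ => 0) fun p : (Fin m → ℕ) × B => weightedOrder w p.1)) (Finset.mem_univ i))
  set ξ : B ⊕ Fin n → L := Sum.elim (fun b => (b : L)) η with hξ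
  set d : B ⊕ Fin n → ℕ := Sum.elim (fun _ => 0) (fun _ => H + 1) with hd
  obtain ⟨E', hE', hind', hcount', hlow⟩ := exists_leading_exponents (K := K) hext hw ξ d
  have hBlow : ∀ k (b : B), weightedOrder w k ≤ H → k ∉ E' (Sum.inl b) := by
    intro k b hk
    refine hlow H ?_ k (Sum.inl b) (by simpa [hd] using hk)
    have hex : ∀ p : {p : (Fin m → ℕ) × (B ⊕ Fin n) | weightedOrder w p.1 + d p.2 ≤ H},
        ∃ b : B, p.1.2 = Sum.inl b := by
      rintro ⟨⟨k, b | i⟩, hp⟩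
      · exact ⟨b, rfl⟩
      · have hp' : weightedOrder w k + (H + 1) ≤ H := hp
        omega
    choose g hg using hex
    have h := hB.indep.comp (fun p => (p.1.1, g p)) fun p q hpq => by
      simp only [Prod.mk.injEq] at hpq
      exact Subtype.ext (Prod.ext hpq.1 (by rw [hg p, hg q, hpq.2]))
    convert h using 1
    funext p
    simp only [Function.comp_apply]
    rw [hg p]
    rfl
  -- If `ηᵢ` had no leading exponent, all its transforms together with those of `B` of order at most
  -- `H` would be independent, against the dependence `t i`.
  have hne : ∀ i, E' (Sum.inr i) ≠ ∅ := by
    intro i hi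
    refine ht i ?_
    set g : (Fin m → ℕ) ⊕ ((Fin m → ℕ) × B) → (Fin m → ℕ) × (B ⊕ Fin n) :=
      Sum.elim (fun k => (k, Sum.inr i)) fun p => (p.1, Sum.inl p.2) with hg
    have hgi : Function.Injective g := by
      rintro (k | p) (l | q) h
      · simpa [hg] using h
      · simp [hg] at h
      · simp [hg] at h
      · simp only [hg, Sum.elim_inr, Prod.mk.injEq, Sum.inl.injEq] at h
        rw [Prod.ext h.1 h.2]
    have hgmem : ∀ a : t i, g a ∈ {p : (Fin m → ℕ) × (B ⊕ Fin n) | p.1 ∉ E' p.2} := by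
      rintro ⟨k | p, ha⟩
      · change k ∉ E' (Sum.inr i)
        rw [hi]
        exact Set.notMem_empty k
      · exact hBlow p.1 p.2 (hHle i p ha)
    have h := hind'.comp (fun a : t i => ⟨g a, hgmem a⟩) fun a b hab => by
      simp only [Subtype.mk.injEq] at hab
      exact Subtype.ext (hgi hab)
    convert h using 1
    funext a
    rcases a with ⟨k | p, ha⟩ <;> rfl
  obtain ⟨N, hN⟩ := AgreesWithQuasi.exists_sum Finset.univ fun j _ =>
    exists_agreesWithQuasi_countCompl hw (hE j)
  obtain ⟨N', hN'⟩ := AgreesWithQuasi.exists_sum Finset.univ fun j _ =>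
    (exists_agreesWithQuasi_countCompl hw (hE' j)).imp' (· + (d j : ℤ)) fun _ h => h.shift (d j)
  have htrunc : ∀ r, offsetTruncation K σL w η (fun _ => 0) r ≤
      offsetTruncation K σL w ξ d (r + (H + 1)) := by
    intro r
    refine IntermediateField.adjoin.mono _ _ _ ?_
    rintro _ ⟨p, hp, rfl⟩
    refine ⟨(p.1, Sum.inr p.2), ?_, rfl⟩
    have hp' : weightedOrder w p.1 ≤ r := hp
    change weightedOrder w p.1 + (H + 1) ≤ r + (H + 1)
    omega
  have hle := (hN.mono (le_max_left _ _)).coeff_le_of_eventually_le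
    ((hN'.shift (-(H + 1 : ℕ))).mono (le_max_right _ _)) (Eventually.of_forall fun r => by
      have := CountsTrdeg.le hcount hcount' (htrunc r)
      simp only [sub_neg_eq_add]
      simpa using this)
  have hsum : ∑ j, (if E' j = ∅ then conicCoeff w else 0) ≤ (Fintype.card B : ℚ) * conicCoeff w := by
    rw [Fintype.sum_sum_type, Finset.sum_eq_zero (s := Finset.univ (α := Fin n)), add_zero]
    · refine (Finset.sum_le_card_nsmul _ _ (conicCoeff w) fun b _ => ?_).trans_eq ?_
      · split_ifs
        · exact le_rfl
        · exact (conicCoeff_pos hw).le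
      · rw [nsmul_eq_mul, Finset.card_univ]
    · intro i _
      rw [if_neg (hne i)]
  have hle' := hle.trans hsum
  rw [Finset.sum_ite, Finset.sum_const, Finset.sum_const_zero, add_zero, nsmul_eq_mul,
    ← Fintype.card_subtype] at hle'
  have hcard : Fintype.card B = B.ncard := by
    rw [← Nat.card_eq_fintype_card, Nat.card_coe_set_eq]
  rw [← hcard]
  exact_mod_cast le_of_mul_le_mul_right hle' (conicCoeff_pos hw)

theorem IsDimensionQuasiPolynomial.eventually_eq {n : ℕ} {η : Fin n → L} {Φ : QuasiPolynomial}
    (hΦ : IsDimensionQuasiPolynomial K σL w η Φ) {E : Fin n → Set (Fin m → ℕ)}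
    (hcount : CountsTrdeg K σL w η (fun _ => 0) E) :
    ∀ᶠ r : ℕ in atTop, evalAt Φ r = ∑ j, countCompl w (E j) r := by
  filter_upwards [hΦ] with r hr
  obtain ⟨D, hD, hD'⟩ := hr
  obtain ⟨D₁, hD₁, hD₁'⟩ := hcount r
  rw [truncation_eq, hD₁, Nat.cast_inj] at hD
  simpa [hD', ← hD] using hD₁'.symm

end Truncation

end WeightedDifference

/-! ### The main theorem -/

open WeightedDifference in
theorem theorem4 {K L : Type*} [Field K] [CharZero K] [Field L] [Algebra K L] {m : ℕ}
    (σK : Translations m K) (σL : Translations m L) (hext : IsDifferenceExtension σK σL)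
    (w : Fin m → ℕ) (hw : ∀ i, 0 < w i)
    {n : ℕ} (η : Fin n → L) (hη : Generates K σL η) :
    ∃ Φ : QuasiPolynomial,
      IsDimensionQuasiPolynomial K σL w η Φ ∧
      Φ.degree ≤ (m : WithBot ℕ) ∧
      IsAlternatingEhrhartSum w Φ ∧
      (∃ c : ℚ, Φ.leadingCoeff = algebraMap ℚ periodicNumber c) ∧
      (∀ (k : ℕ) (ζ : Fin k → L), Generates K σL ζ →
        ∀ Ψ : QuasiPolynomial, IsDimensionQuasiPolynomial K σL w ζ Ψ →
          Ψ.degree = Φ.degree ∧ Ψ.leadingCoeff = Φ.leadingCoeff) ∧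
      ∃ a : ℕ, HasDiffTrdeg K σL a ∧
        Φ.coeff m = algebraMap ℚ periodicNumber ((a : ℚ) / ((m ! : ℚ) * ∏ i, (w i : ℚ))) := by
  classical
  obtain ⟨E, hE, hind, hcount, -⟩ := exists_leading_exponents (K := K) hext hw η (fun _ => 0)
  obtain ⟨Φ, hΦ, hdeg, halt, hlead, hcoeff⟩ := exists_quasiPolynomial_sum_countCompl hw hE
  refine ⟨Φ, ?_, hdeg, halt, ?_, fun k ζ hζ Ψ hΨ => ?_, Fintype.card {j // E j = ∅}, ?_, hcoeff⟩
  · filter_upwards [hΦ] with r hr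
    obtain ⟨D, hD, hD'⟩ := hcount r
    refine ⟨D, ?_, ?_⟩
    · rw [truncation_eq]
      exact hD
    · rw [hr, ← hD']
      simp
  · rcases hlead with ⟨rfl, -⟩ | ⟨d, e, -, -, -, h⟩
    · exact ⟨0, by simp⟩
    · exact ⟨e, h⟩
  · obtain ⟨E', hE', -, hcount', -⟩ := exists_leading_exponents (K := K) hext hw ζ (fun _ => 0)
    have hlead' : IsLeading Ψ fun t => ∑ j, countCompl w (E' j) t :=
      isLeading_of_hasPosLeading (HasPosLeading.sum Finset.univ fun j _ =>
        hasPosLeading_countCompl hw (hE' j)) (hΨ.eventually_eq hcount')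
    obtain ⟨c, hc⟩ := hζ.exists_offsetTruncation_le (w := w) hext η
    obtain ⟨c', hc'⟩ := hη.exists_offsetTruncation_le (w := w) hext ζ
    refine hlead.degree_eq_and_leadingCoeff_eq hlead' (c := c) (c' := c') (fun r => ?_) fun r => ?_
    · simpa using CountsTrdeg.le hcount hcount' (hc r)
    · simpa using CountsTrdeg.le hcount' hcount (hc' r)
  · refine ⟨⟨_, isDiffTranscendenceBasis_range hext hw hη hE hcount hind⟩, fun B hB => ?_⟩
    obtain ⟨hfin, hle⟩ := hB.finite_and_ncard_le hext hw hη hE hcount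
    exact ⟨hfin, hle.antisymm (hB.le_ncard hext hw hE hcount hfin)⟩
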